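/- Let $\mathbb K$ be a finite field with $q$ elements. For $n\ge 0$ let $U_n=U_n(\mathbb K)$ be the group of upper unitriangular $n\times n$ matrices over $\mathbb K$ and $\mathfrak n_n=\{g-1 : g\in U_n\}$ the space of strictly upper triangular matrices. For a set partition $\pi$ of $[n]=\{1,\dots,n\}$ (written $\pi\vdash[n]$) let $D(\pi)$ be its set of arcs, i.e. of pairs $i<j$ lying in one block with no element of that block strictly between them, and put $$\dim(\pi)=\sum_{(i,j)\in D(\pi)}(j-i),\qquad \operatorname{crs}(\pi)=\#\{((i,j),(k,l))\in D(\pi)^2 : i<k<j<l\}.$$ Fix a nontrivial additive character $\theta:\mathbb K\to\mathbb C^\times$. For $\varphi:D(\pi)\to\mathbb K^\times$ let $\lambda_{\pi,\varphi}\in\mathfrak n_n^*$ be $X\mapsto\sum_{(i,j)\in D(\pi)}\varphi(i,j)X_{ij}$, and let $\chi^\pi:U_n\to\mathbb C$ be the supercharacter $$\chi^\pi(g)=\sum_{\varphi}\frac{|U_n\lambda_{\pi,\varphi}|}{|U_n\lambda_{\pi,\varphi}U_n|}\sum_{\mu\in U_n\lambda_{\pi,\varphi}U_n}\theta(\mu(g-1)),$$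 where the orbit $U_n\lambda U_n$ consists of the functionals $X\mapsto\lambda(aXb)$, $a,b\in U_n$, and $U_n\lambda$ of the functionals $X\mapsto\lambda(aX)$, $a\in U_n$. With $\langle\phi,\psi\rangle=\frac1{|G|}\sum_{g\in G}\overline{\phi(g)}\psi(g)$ for functions on a finite group $G$, the superplancherel measure is $$\mathrm{SPl}_n(\pi)=\frac1{|U_n|}\,\frac{\chi^\pi(1)^2}{\langle\chi^\pi,\chi^\pi\rangle}\qquad(\pi\vdash[n]).$$ Embed $U_n$ in $U_{n+1}$ by $A\mapsto\begin{pmatrix}A&0\\0&1\end{pmatrix}$. The Bratteli diagram of set partitions has the set partitions of $[n]$ as its $n$-th level, and the multiplicity of the edge from $\pi\vdash[n]$ to $\sigma\vdash[n+1]$ is $\kappa(\pi,\sigma)=\langle\chi^\pi,\mathrm{Res}_{U_n}\chi^\sigma\rangle/\langle\chi^\pi,\chi^\pi\rangle$ (there is an edge when this is nonzero). The transition probabilities defined by the superplancherel measures are $$\mathrm{tr}(\pi,\sigma)=\frac{\chi^\pi(1)\,\mathrm{SPl}_{n+1}(\sigma)\,\kappa(\pi,\sigma)}{\chi^\sigma(1)\,\mathrm{SPl}_n(\pi)}.$$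 Then there is exactly one probability measure $P$ on the space of infinite paths $\pi_0\nearrow\pi_1\nearrow\pi_2\nearrow\cdots$ of this diagram (with the product $\sigma$-algebra) such that $P(\pi_0=\gamma_0,\dots,\pi_N=\gamma_N)=\prod_{n<N}\mathrm{tr}(\gamma_n,\gamma_{n+1})$ for all $N$ and all $\gamma_n\vdash[n]$. Under $P$ the random set partition $\pi_n$ has distribution $\mathrm{SPl}_n$ for every $n$, and, as $n\to\infty$, $$\frac{\dim(\pi_n)}{n^2}\to\frac14\quad P\text{-almost surely},\qquad \operatorname{crs}(\pi_n)=o_P(n^2),$$ that is, $\operatorname{crs}(\pi_n)/n^2\to 0$ in $P$-probability. -/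

import Mathlib

open MeasureTheory Filter Topology

/-! ### Set partitions and their statistics -/

/-- Set partitions of an `n`-element set; the elements `1, …, n` are indexed by `Fin n`
in increasing order. -/
abbrev SetPartition (n : ℕ) := Finpartition (Finset.univ : Finset (Fin n))

instance (n : ℕ) : MeasurableSpace (SetPartition n) := ⊤

namespace SetPartition

variable {n : ℕ}

open scoped Classical in
/-- The arcs `(i, j)`: `i < j` are consecutive elements of a common block. -/
noncomputable def arcs (π : SetPartition n) : Finset (Fin n × Fin n) :=
  {a | a.1 < a.2 ∧ ∃ B ∈ π.parts, a.1 ∈ B ∧ a.2 ∈ B ∧ ∀ k ∈ B, ¬ (a.1 < k ∧ k < a.2)}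

/-- The dimension: the sum of `j - i` over all arcs `(i, j)` (always `i < j`). -/
noncomputable def dim (π : SetPartition n) : ℕ :=
  ∑ a ∈ π.arcs, ((a.2 : ℕ) - (a.1 : ℕ))

open scoped Classical in
/-- The number of crossings: pairs of arcs `(i, j)`, `(k, l)` with `i < k < j < l`. -/
noncomputable def crs (π : SetPartition n) : ℕ :=
  ((π.arcs ×ˢ π.arcs).filter fun p =>
    p.1.1 < p.2.1 ∧ p.2.1 < p.1.2 ∧ p.1.2 < p.2.2).card

end SetPartition

/-! ### Unitriangular groups -/

section Unitriangular

variable (K : Type*) [Field K] (n : ℕ)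

/-- The group `U_n(K)` of upper unitriangular `n × n` matrices. -/
def unitriangular : Subgroup (Matrix (Fin n) (Fin n) K)ˣ where
  carrier := {g | (∀ i, g.val i i = 1) ∧ ∀ i j, j < i → g.val i j = 0}
  one_mem' := by
    refine ⟨fun i => by simp, fun i j h => ?_⟩
    simp [h.ne']
  mul_mem' := by
    rintro a b ⟨ha, ha'⟩ ⟨hb, hb'⟩
    refine ⟨fun i => ?_, fun i j h => ?_⟩
    · rw [Units.val_mul, Matrix.mul_apply, Finset.sum_eq_single i]
      · rw [ha, hb, one_mul]
      · intro k _ hk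
        rcases lt_or_gt_of_ne hk with h | h
        · rw [ha' _ _ h, zero_mul]
        · rw [hb' _ _ h, mul_zero]
      · simp
    · rw [Units.val_mul, Matrix.mul_apply]
      refine Finset.sum_eq_zero fun k _ => ?_
      rcases lt_or_ge k i with hk | hk
      · rw [ha' _ _ hk, zero_mul]
      · rw [hb' _ _ (lt_of_lt_of_le h hk), mul_zero]
  inv_mem' := by
    rintro a ⟨ha, ha'⟩
    have hbt : Matrix.BlockTriangular a.val id := fun i j h => ha' i j h
    have hinv : ∀ i j, j < i → (a⁻¹).val i j = 0 := by
      intro i j h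
      have : Invertible a.val := a.invertible
      have := Matrix.blockTriangular_inv_of_blockTriangular hbt h
      rwa [← Matrix.coe_units_inv] at this
    refine ⟨fun i => ?_, hinv⟩
    have h1 : (a.val * (a⁻¹).val) i i = 1 := by simp
    rw [Matrix.mul_apply, Finset.sum_eq_single i] at h1
    · rwa [ha, one_mul] at h1
    · intro k _ hk
      rcases lt_or_gt_of_ne hk with h | h
      · rw [ha' _ _ h, zero_mul]
      · rw [hinv _ _ h, mul_zero]
    · simp

/-- The space `𝔫_n(K)` of strictly upper triangular `n × n` matrices. -/
def strictUpper : Submodule K (Matrix (Fin n) (Fin n) K) where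
  carrier := {X | ∀ i j, j ≤ i → X i j = 0}
  zero_mem' := by intro i j _; rfl
  add_mem' := by
    intro X Y hX hY i j h
    rw [Matrix.add_apply, hX i j h, hY i j h, add_zero]
  smul_mem' := by
    intro c X hX i j h
    rw [Matrix.smul_apply, hX i j h, smul_zero]

noncomputable instance [Finite K] : Fintype (unitriangular K n) := Fintype.ofFinite _

variable {K n}

/-- `g - 1`, as an element of `𝔫_n(K)`, for `g` in `U_n(K)`. -/
def subOne (g : unitriangular K n) : strictUpper K n :=
  ⟨g.val.val - 1, by
    intro i j h
    rcases h.lt_or_eq with h | h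
    · simp [g.2.2 i j h, h.ne']
    · subst h; simp [g.2.1 j]⟩

/-- The linear map `X ↦ a X b` on `𝔫_n(K)`, for `a, b` in `U_n(K)`. -/
def twoSidedMul (a b : unitriangular K n) : strictUpper K n →ₗ[K] strictUpper K n where
  toFun X := ⟨a.val.val * X.val * b.val.val, by
    intro i j h
    rw [Matrix.mul_apply]
    refine Finset.sum_eq_zero fun k _ => ?_
    rcases lt_or_ge j k with hk | hk
    · rw [b.2.2 k j hk, mul_zero]
    · rw [Matrix.mul_apply, Finset.sum_eq_zero, zero_mul]
      intro l _
      rcases lt_or_ge l i with hl | hl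
      · rw [a.2.2 i l hl, zero_mul]
      · rw [X.2 l k ((hk.trans h).trans hl), mul_zero]⟩
  map_add' X Y := by
    apply Subtype.ext
    simp [mul_add, add_mul]
  map_smul' c X := by
    apply Subtype.ext
    simp

/-- The block diagonal matrix with blocks `A` and `1`. -/
def blockSucc : Matrix (Fin n) (Fin n) K →* Matrix (Fin (n + 1)) (Fin (n + 1)) K where
  toFun A :=
    (Matrix.fromBlocks A 0 0 (1 : Matrix (Fin 1) (Fin 1) K)).submatrix
      finSumFinEquiv.symm finSumFinEquiv.symm
  map_one' := by rw [Matrix.fromBlocks_one, Matrix.submatrix_one_equiv]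
  map_mul' A B := by
    rw [Matrix.submatrix_mul_equiv, Matrix.fromBlocks_multiply]
    simp

/-- The inclusion `U_n(K) → U_{n+1}(K)`, sending `A` to the block diagonal matrix with blocks
`A` and `1`. -/
def unitriangularSucc (g : unitriangular K n) : unitriangular K (n + 1) :=
  ⟨Units.map blockSucc g.val, by
    refine ⟨fun i => ?_, fun i j h => ?_⟩
    · refine Fin.addCases (fun i => ?_) (fun i => ?_) i
      · simpa [blockSucc] using g.2.1 i
      · simp [blockSucc]
    · revert h
      refine Fin.addCases (fun i => ?_) (fun i => ?_) i <;>
        refine Fin.addCases (fun j => ?_) (fun j => ?_) j <;> intro h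
      · have := g.2.2 i j h
        simpa [blockSucc] using this
      · simp [blockSucc]
      · simp [blockSucc]
      · exact absurd h (by rw [Subsingleton.elim i j]; exact lt_irrefl _)⟩

end Unitriangular

/-! ### Supercharacters of the unitriangular group -/

section Supercharacters

variable {K : Type*} [Field K] [Fintype K] {n : ℕ}

/-- The functional `X ↦ ∑ φ(i,j) X_{ij}` on `𝔫_n(K)`, the sum being over the arcs of `π`, for a
colouring `φ` of the arcs of `π` by nonzero scalars. -/
noncomputable def arcFunctional (π : SetPartition n) (φ : π.arcs → Kˣ) : Module.Dual K (strictUpper K n) where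
  toFun X := ∑ a : π.arcs, (φ a : K) * X.val a.val.1 a.val.2
  map_add' X Y := by simp [mul_add, Finset.sum_add_distrib]
  map_smul' c X := by simp [Finset.mul_sum, mul_left_comm]

open scoped Classical in
/-- The orbit of a functional under the left action of `U_n(K)`. -/
noncomputable def leftOrbit (l : Module.Dual K (strictUpper K n)) :
    Finset (Module.Dual K (strictUpper K n)) :=
  Finset.univ.image fun a : unitriangular K n => l ∘ₗ twoSidedMul a 1

open scoped Classical in
/-- The orbit of a functional under the two-sided action of `U_n(K)`. -/
noncomputable def twoSidedOrbit (l : Module.Dual K (strictUpper K n)) :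
    Finset (Module.Dual K (strictUpper K n)) :=
  Finset.univ.image fun p : unitriangular K n × unitriangular K n => l ∘ₗ twoSidedMul p.1 p.2

/-- The supercharacter of the algebra group `U_n(K) = 1 + 𝔫_n(K)` attached to the functional `l`:
`g ↦ |U l| / |U l U| * ∑_{m ∈ U l U} θ (m (g - 1))`. -/
noncomputable def functionalSupercharacter (θ : AddChar K ℂ)
    (l : Module.Dual K (strictUpper K n)) (g : unitriangular K n) : ℂ :=
  ((leftOrbit l).card : ℂ) / ((twoSidedOrbit l).card : ℂ) *
    ∑ m ∈ twoSidedOrbit l, θ (m (subOne g))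

open scoped Classical in
/-- The supercharacter `χ^π` of `U_n(K)` attached to an uncoloured set partition: the sum of the
supercharacters `χ^{π,φ}` over all colourings `φ` of the arcs by nonzero scalars. -/
noncomputable def supercharacter (θ : AddChar K ℂ) (π : SetPartition n)
    (g : unitriangular K n) : ℂ :=
  ∑ φ : π.arcs → Kˣ, functionalSupercharacter θ (arcFunctional π φ) g

/-- The inner product of complex functions on a finite group. -/
noncomputable def charInner {G : Type*} [Fintype G] (f g : G → ℂ) : ℂ :=
  (Fintype.card G : ℂ)⁻¹ * ∑ x, (starRingEnd ℂ) (f x) * g x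

/-- The superplancherel weight `χ(1)² / (|G| ⟨χ, χ⟩)` of a supercharacter of a finite group. -/
noncomputable def superPlancherelWeight {G : Type*} [Group G] [Fintype G] (χ : G → ℂ) : ℂ :=
  (Fintype.card G : ℂ)⁻¹ * (χ 1 ^ 2 / charInner χ χ)

/-- The superplancherel measure of `U_n(K)`, on set partitions. -/
noncomputable def superPlancherel (θ : AddChar K ℂ) (π : SetPartition n) : ℂ :=
  superPlancherelWeight (supercharacter θ π)

/-- The multiplicity `κ(π, σ) = ⟨χ^π, Res χ^σ⟩ / ⟨χ^π, χ^π⟩` of the edge from `π` to `σ` in the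
Bratteli diagram of set partitions. -/
noncomputable def edgeMultiplicity (θ : AddChar K ℂ) (π : SetPartition n)
    (σ : SetPartition (n + 1)) : ℂ :=
  charInner (supercharacter θ π) (fun g => supercharacter θ σ (unitriangularSucc g)) /
    charInner (supercharacter θ π) (supercharacter θ π)

/-- The transition probability from `π` to `σ` defined by the superplancherel measures:
`χ^π(1) SPl_{n+1}(σ) κ(π, σ) / (χ^σ(1) SPl_n(π))`. -/
noncomputable def transition (θ : AddChar K ℂ) (π : SetPartition n)
    (σ : SetPartition (n + 1)) : ℂ :=
  supercharacter θ π 1 * superPlancherel θ σ * edgeMultiplicity θ π σ /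
    (supercharacter θ σ 1 * superPlancherel θ π)

end Supercharacters

/-! ### Infinite paths on the Bratteli diagram of set partitions -/

section Paths

variable {K : Type*} [Field K] [Fintype K]

/-- Infinite paths `π_0 ↗ π_1 ↗ π_2 ↗ …` on the Bratteli diagram of set partitions, with the
product σ-algebra. -/
abbrev BratteliPath (θ : AddChar K ℂ) :=
  {ω : ∀ n : ℕ, SetPartition n // ∀ n, edgeMultiplicity θ (ω n) (ω (n + 1)) ≠ 0}

/-- `P` is the probability measure on the space of infinite paths defined by the system of
superplancherel measures: the law of the Markov chain started at the root, the unique set partition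
of the empty set, with the transition probabilities `transition`. -/
def IsPathMeasure (θ : AddChar K ℂ) (P : Measure (BratteliPath θ)) : Prop :=
  IsProbabilityMeasure P ∧
    ∀ (N : ℕ) (γ : ∀ n : ℕ, SetPartition n),
      ((P.real {ω | ∀ n ≤ N, ω.val n = γ n} : ℝ) : ℂ) =
        ∏ n ∈ Finset.range N, transition θ (γ n) (γ (n + 1))

end Paths

/-! Write `q` for the cardinality of `K`. Call the union over all colourings of the two-sided orbits
of `arcFunctional π φ` the arc class of `π`. The dual of `strictUpper K n` is the disjoint union of
the arc classes: Gaussian elimination brings every functional to an `arcFunctional`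
(`exists_mem_arcClass`), and the ranks of corners of its matrix of entries determine the arcs
(`eq_of_mem_arcClass`). Diagonal matrices permute the colourings transitively, so `χ^π` is a
positive multiple of the sum of `θ (m (g - 1))` over the arc class (`exists_supercharacter_eq`).
Orthogonality of the functions `g ↦ θ (m (g - 1))` turns all the data into counts. The
superplancherel measure is the law of the type of a uniformly random functional
(`superPlancherel_eq`), and `transition θ π σ` is the chance that a uniformly random extension of a
functional of type `π` has type `σ` (`transition_eq`). Hence the path measure is realised by an
infinite array of independent uniform entries, a path recording the types of its corners
(`exists_isPathMeasure`). It is unique because it is prescribed on cylinders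
(`IsPathMeasure.unique`). For the asymptotics, orbit counting gives `|arcClass π| * q ^ crs π ≤ q ^
(2 * dim π)` (`card_arcClass_mul_pow_crs_le`), while `|U_n| = q ^ ((n² - n) / 2)` and there are at
most `n ^ n` set partitions. So `2 dim - crs < n² / 2 - ε n²` has summable probability, and
Borel–Cantelli excludes it for large `n` almost surely. With the deterministic bound `4 dim ≤ n²`
(`SetPartition.four_mul_dim_le`), this forces both limits, even the one for `crs` almost surely. -/

section BimoduleAction

/-! ### Unitriangular and diagonal actions on functionals, in coordinates. -/

variable {K : Type*} [Field K] {n : ℕ}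

@[simp] lemma coe_twoSidedMul (a b : unitriangular K n) (X : strictUpper K n) :
    (twoSidedMul a b X : Matrix (Fin n) (Fin n) K) = a.val.val * X.val * b.val.val := rfl

@[simp] lemma twoSidedMul_one_one :
    twoSidedMul (1 : unitriangular K n) 1 = LinearMap.id := by
  ext X : 2
  simp

lemma twoSidedMul_comp (a b c d : unitriangular K n) :
    twoSidedMul a b ∘ₗ twoSidedMul c d = twoSidedMul (a * c) (d * b) := by
  ext X : 2
  simp [Matrix.mul_assoc]

lemma comp_twoSidedMul_inv (l : Module.Dual K (strictUpper K n)) (a b : unitriangular K n) :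
    (l ∘ₗ twoSidedMul a b) ∘ₗ twoSidedMul a⁻¹ b⁻¹ = l := by
  rw [LinearMap.comp_assoc, twoSidedMul_comp]
  simp

/-- The unitriangular matrix `1 + X`. -/
noncomputable def oneAdd (X : strictUpper K n) : unitriangular K n :=
  have h : (1 + X.val).det = 1 := by
    rw [Matrix.det_of_isUpperTriangular]
    · exact Finset.prod_eq_one fun i _ => by simp [X.2 i i le_rfl]
    · intro i j hij
      have h : j < i := hij
      simp [X.2 i j h.le, h.ne']
  ⟨Matrix.nonsingInvUnit (1 + X.val) (by rw [h]; exact isUnit_one), by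
    refine ⟨fun i => ?_, fun i j hij => ?_⟩
    · change (1 + X.val : Matrix (Fin n) (Fin n) K) i i = 1
      simp [X.2 i i le_rfl]
    · change (1 + X.val : Matrix (Fin n) (Fin n) K) i j = 0
      simp [X.2 i j hij.le, hij.ne']⟩

@[simp] lemma coe_oneAdd (X : strictUpper K n) :
    ((oneAdd X).val.val : Matrix (Fin n) (Fin n) K) = 1 + X.val := rfl

lemma subOne_oneAdd (X : strictUpper K n) : subOne (oneAdd X) = X := by
  apply Subtype.ext
  simp [subOne]

lemma subOne_bijective : Function.Bijective (subOne : unitriangular K n → strictUpper K n) := by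
  refine ⟨fun g h e => ?_, fun X => ⟨oneAdd X, subOne_oneAdd X⟩⟩
  have e' : g.val.val - 1 = h.val.val - 1 := congrArg Subtype.val e
  exact Subtype.ext (Units.ext (by simpa using e'))

@[simp] lemma subOne_one : subOne (1 : unitriangular K n) = 0 := by
  apply Subtype.ext
  simp [subOne]

/-! ### The action of diagonal matrices -/

/-- The linear map `X ↦ diag(t) X` on strictly upper triangular matrices. -/
def rowScale (t : Fin n → Kˣ) : strictUpper K n →ₗ[K] strictUpper K n where
  toFun X := ⟨Matrix.diagonal (fun i => (t i : K)) * X.val, by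
    intro i j h
    rw [Matrix.diagonal_mul, X.2 i j h, mul_zero]⟩
  map_add' X Y := by
    apply Subtype.ext
    simp [mul_add]
  map_smul' c X := by
    apply Subtype.ext
    simp

@[simp] lemma coe_rowScale (t : Fin n → Kˣ) (X : strictUpper K n) :
    (rowScale t X : Matrix (Fin n) (Fin n) K) = Matrix.diagonal (fun i => (t i : K)) * X.val := rfl

lemma rowScale_comp (s t : Fin n → Kˣ) : rowScale s ∘ₗ rowScale t = rowScale (s * t) := by
  ext X : 2
  simp [← Matrix.mul_assoc, Matrix.diagonal_mul_diagonal]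

@[simp] lemma rowScale_one : rowScale (1 : Fin n → Kˣ) = LinearMap.id := by
  ext X : 2
  simp

/-- The invertible diagonal matrix with given entries. -/
def diagUnit (t : Fin n → Kˣ) : (Matrix (Fin n) (Fin n) K)ˣ where
  val := Matrix.diagonal fun i => (t i : K)
  inv := Matrix.diagonal fun i => (t i : K)⁻¹
  val_inv := by simp [Matrix.diagonal_mul_diagonal]
  inv_val := by simp [Matrix.diagonal_mul_diagonal]

@[simp] lemma coe_diagUnit (t : Fin n → Kˣ) :
    (diagUnit t : Matrix (Fin n) (Fin n) K) = Matrix.diagonal fun i => (t i : K) := rfl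

@[simp] lemma coe_inv_diagUnit (t : Fin n → Kˣ) :
    ((diagUnit t)⁻¹.val : Matrix (Fin n) (Fin n) K) = Matrix.diagonal fun i => (t i : K)⁻¹ := rfl

/-- The conjugate of a unitriangular matrix by a diagonal matrix. -/
def diagConj (t : Fin n → Kˣ) (a : unitriangular K n) : unitriangular K n :=
  ⟨diagUnit t * a.val * (diagUnit t)⁻¹, by
    refine ⟨fun i => ?_, fun i j h => ?_⟩
    · simp only [Units.val_mul, coe_diagUnit, coe_inv_diagUnit, Matrix.diagonal_mul,
        Matrix.mul_diagonal, a.2.1 i]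
      simp
    · simp only [Units.val_mul, coe_diagUnit, coe_inv_diagUnit, Matrix.diagonal_mul,
        Matrix.mul_diagonal, a.2.2 i j h]
      simp⟩

@[simp] lemma coe_diagConj (t : Fin n → Kˣ) (a : unitriangular K n) :
    (diagConj t a).val = diagUnit t * a.val * (diagUnit t)⁻¹ := rfl

/-- Diagonal matrices normalise the unitriangular group; hence row scalings carry orbits to orbits.
-/
lemma rowScale_comp_twoSidedMul (t : Fin n → Kˣ) (a b : unitriangular K n) :
    rowScale t ∘ₗ twoSidedMul a b = twoSidedMul (diagConj t a) b ∘ₗ rowScale t := by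
  ext X : 2
  simp only [LinearMap.comp_apply, coe_rowScale, coe_twoSidedMul, coe_diagConj, ← coe_diagUnit,
    Units.val_mul, Matrix.mul_assoc, Units.inv_mul_cancel_left]

lemma diagUnit_inv (t : Fin n → Kˣ) : diagUnit t⁻¹ = (diagUnit t)⁻¹ := by
  apply Units.ext
  rw [coe_inv_diagUnit, coe_diagUnit]
  simp

lemma diagConj_diagConj_inv (t : Fin n → Kˣ) (a : unitriangular K n) :
    diagConj t (diagConj t⁻¹ a) = a := by
  apply Subtype.ext
  rw [coe_diagConj, coe_diagConj, diagUnit_inv]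
  group

lemma comp_rowScale_inv (l : Module.Dual K (strictUpper K n)) (t : Fin n → Kˣ) :
    (l ∘ₗ rowScale t) ∘ₗ rowScale t⁻¹ = l := by
  rw [LinearMap.comp_assoc, rowScale_comp]
  simp

lemma comp_rowScale_injective (t : Fin n → Kˣ) :
    Function.Injective fun l : Module.Dual K (strictUpper K n) => l ∘ₗ rowScale t := by
  intro l m h
  have := congrArg (· ∘ₗ rowScale t⁻¹) h
  simpa only [comp_rowScale_inv] using this

/-! ### Matrix entries of functionals -/

/-- The elementary matrix at `(i, j)`, or `0` when `(i, j)` is not above the diagonal. -/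
noncomputable def strictSingle (i j : Fin n) : strictUpper K n :=
  if h : i < j then ⟨Matrix.single i j 1, by
    intro k l hkl
    apply Matrix.single_apply_of_ne
    rintro ⟨rfl, rfl⟩
    exact absurd h (not_lt.2 hkl)⟩
  else 0

lemma coe_strictSingle {i j : Fin n} (h : i < j) :
    (strictSingle i j : strictUpper K n).val = Matrix.single i j 1 := by
  simp [strictSingle, h]

lemma strictSingle_of_le {i j : Fin n} (h : j ≤ i) : (strictSingle i j : strictUpper K n) = 0 := by
  simp [strictSingle, not_lt.2 h]

lemma sum_smul_strictSingle (X : strictUpper K n) :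
    X = ∑ i, ∑ j, X.val i j • strictSingle i j := by
  apply Subtype.ext
  conv_lhs => rw [Matrix.matrix_eq_sum_single X.val]
  simp only [AddSubmonoidClass.coe_finsetSum, SetLike.val_smul]
  refine Finset.sum_congr rfl fun i _ => Finset.sum_congr rfl fun j _ => ?_
  rcases lt_or_ge i j with h | h
  · simp [coe_strictSingle h]
  · simp [strictSingle_of_le h, X.2 i j h]

/-- The entries of a functional, so that `l X = ∑ entry l i j * X i j`. -/
noncomputable def entry (l : Module.Dual K (strictUpper K n)) (i j : Fin n) : K :=
  l (strictSingle i j)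

lemma entry_of_le (l : Module.Dual K (strictUpper K n)) {i j : Fin n} (h : j ≤ i) :
    entry l i j = 0 := by
  rw [entry, strictSingle_of_le h, map_zero]

lemma apply_eq_sum_entry (l : Module.Dual K (strictUpper K n)) (X : strictUpper K n) :
    l X = ∑ i, ∑ j, entry l i j * X.val i j := by
  conv_lhs => rw [sum_smul_strictSingle X]
  simp [entry, mul_comm]

lemma dual_ext {l m : Module.Dual K (strictUpper K n)}
    (h : ∀ i j, i < j → entry l i j = entry m i j) : l = m := by
  ext X
  rw [apply_eq_sum_entry, apply_eq_sum_entry m]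
  refine Finset.sum_congr rfl fun i _ => Finset.sum_congr rfl fun j _ => ?_
  rcases lt_or_ge i j with hij | hij
  · rw [h i j hij]
  · rw [entry_of_le l hij, entry_of_le m hij]

/-- The functional with given entries. -/
noncomputable def ofEntries (C : Fin n → Fin n → K) : Module.Dual K (strictUpper K n) where
  toFun X := ∑ i, ∑ j, C i j * X.val i j
  map_add' X Y := by simp [mul_add, Finset.sum_add_distrib]
  map_smul' c X := by simp [Finset.mul_sum, mul_left_comm]

lemma sum_mul_single (C : Fin n → Fin n → K) (i j : Fin n) :
    ∑ k, ∑ l, C k l * (Matrix.single i j 1 : Matrix (Fin n) (Fin n) K) k l = C i j := by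
  rw [Finset.sum_eq_single i, Finset.sum_eq_single j]
  · simp
  · intro l _ hl
    simp [hl.symm]
  · simp
  · intro k _ hk
    refine Finset.sum_eq_zero fun l _ => ?_
    simp [hk.symm]
  · simp

lemma entry_ofEntries (C : Fin n → Fin n → K) {i j : Fin n} (h : i < j) :
    entry (ofEntries C) i j = C i j := by
  rw [entry, ofEntries, LinearMap.coe_mk, AddHom.coe_mk, coe_strictSingle h, sum_mul_single]

/-- On entries the left action is a row operation: since `X` is strictly upper triangular, row `k`
receives multiples of rows `i < k` only. Dually, in `entry_comp_right` a column receives multiples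
of later columns only. -/
lemma entry_comp_left (m : Module.Dual K (strictUpper K n)) (X : strictUpper K n) {k l : Fin n}
    (h : k < l) :
    entry (m ∘ₗ twoSidedMul (oneAdd X) 1) k l = entry m k l + ∑ i, X.val i k * entry m i l := by
  have e : twoSidedMul (oneAdd X) 1 (strictSingle k l) =
      strictSingle k l + ∑ i, X.val i k • strictSingle i l := by
    apply Subtype.ext
    simp only [coe_twoSidedMul, coe_oneAdd, OneMemClass.coe_one, Units.val_one, Matrix.mul_one,
      add_mul, one_mul, Submodule.coe_add, AddSubmonoidClass.coe_finsetSum, SetLike.val_smul]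
    congr 1
    ext i j
    rw [coe_strictSingle h, Matrix.sum_apply, Finset.sum_eq_single i]
    · rcases lt_or_ge i l with hil | hil
      · rw [coe_strictSingle hil]
        by_cases hj : l = j
        · subst hj; simp
        · simp [hj, Matrix.mul_apply]
      · rw [strictSingle_of_le hil]
        by_cases hj : l = j
        · subst hj; simp [X.2 i k (h.le.trans hil)]
        · simp [hj, Matrix.mul_apply]
    · intro b _ hb
      rcases lt_or_ge b l with hil | hil
      · simp [coe_strictSingle hil, hb]
      · simp [strictSingle_of_le hil]
    · simp
  rw [entry, LinearMap.comp_apply, e]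
  simp [entry]

lemma entry_comp_right (m : Module.Dual K (strictUpper K n)) (X : strictUpper K n) {k l : Fin n}
    (h : k < l) :
    entry (m ∘ₗ twoSidedMul 1 (oneAdd X)) k l = entry m k l + ∑ j, entry m k j * X.val l j := by
  have e : twoSidedMul 1 (oneAdd X) (strictSingle k l) =
      strictSingle k l + ∑ j, X.val l j • strictSingle k j := by
    apply Subtype.ext
    simp only [coe_twoSidedMul, coe_oneAdd, OneMemClass.coe_one, Units.val_one, Matrix.one_mul,
      mul_add, mul_one, Submodule.coe_add, AddSubmonoidClass.coe_finsetSum, SetLike.val_smul]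
    congr 1
    ext i j
    rw [coe_strictSingle h, Matrix.sum_apply, Finset.sum_eq_single j]
    · rcases lt_or_ge k j with hil | hil
      · rw [coe_strictSingle hil]
        by_cases hj : k = i
        · subst hj; simp
        · simp [hj, Matrix.mul_apply]
      · rw [strictSingle_of_le hil]
        by_cases hj : k = i
        · subst hj; simp [X.2 l j (hil.trans h.le)]
        · simp [hj, Matrix.mul_apply]
    · intro b _ hb
      rcases lt_or_ge k b with hil | hil
      · simp [coe_strictSingle hil, hb]
      · simp [strictSingle_of_le hil]
    · simp
  rw [entry, LinearMap.comp_apply, e]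
  simp [entry, mul_comm]

end BimoduleAction

/-! ### Arcs: at most one starts and at most one ends at each point. -/

namespace SetPartition

variable {n : ℕ}

lemma mem_arcs {π : SetPartition n} {i j : Fin n} :
    (i, j) ∈ π.arcs ↔ i < j ∧ ∃ B ∈ π.parts, i ∈ B ∧ j ∈ B ∧ ∀ k ∈ B, ¬ (i < k ∧ k < j) := by
  simp [arcs]

lemma lt_of_mem_arcs {π : SetPartition n} {i j : Fin n} (h : (i, j) ∈ π.arcs) : i < j :=
  (mem_arcs.1 h).1

lemma arcs_right_unique {π : SetPartition n} {i j j' : Fin n} (h : (i, j) ∈ π.arcs)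
    (h' : (i, j') ∈ π.arcs) : j = j' := by
  obtain ⟨hij, B, hB, hiB, hjB, hk⟩ := mem_arcs.1 h
  obtain ⟨hij', B', hB', hiB', hjB', hk'⟩ := mem_arcs.1 h'
  obtain rfl := π.eq_of_mem_parts hB hB' hiB hiB'
  rcases lt_trichotomy j j' with h1 | h1 | h1
  · exact absurd ⟨hij, h1⟩ (hk' _ hjB)
  · exact h1
  · exact absurd ⟨hij', h1⟩ (hk _ hjB')

lemma arcs_left_unique {π : SetPartition n} {i i' j : Fin n} (h : (i, j) ∈ π.arcs)
    (h' : (i', j) ∈ π.arcs) : i = i' := by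
  obtain ⟨hij, B, hB, hiB, hjB, hk⟩ := mem_arcs.1 h
  obtain ⟨hij', B', hB', hiB', hjB', hk'⟩ := mem_arcs.1 h'
  obtain rfl := π.eq_of_mem_parts hB hB' hjB hjB'
  rcases lt_trichotomy i i' with h1 | h1 | h1
  · exact absurd ⟨h1, hij'⟩ (hk _ hiB')
  · exact h1
  · exact absurd ⟨h1, hij⟩ (hk' _ hiB)

end SetPartition

/-! ### Arc classes, and supercharacters as sums over them. -/

section Classes

variable {K : Type*} [Field K] {n : ℕ}

lemma arcFunctional_apply (π : SetPartition n) (φ : π.arcs → Kˣ) (X : strictUpper K n) :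
    arcFunctional π φ X = ∑ a : π.arcs, (φ a : K) * X.val a.val.1 a.val.2 := rfl

lemma entry_arcFunctional_of_mem (π : SetPartition n) (φ : π.arcs → Kˣ) (a : π.arcs) :
    entry (arcFunctional π φ) a.1.1 a.1.2 = φ a := by
  rw [entry, arcFunctional_apply, coe_strictSingle (SetPartition.lt_of_mem_arcs a.2),
    Finset.sum_eq_single a]
  · simp
  · intro b _ hb
    rw [Matrix.single_apply_of_ne, mul_zero]
    rintro ⟨h1, h2⟩
    exact hb (Subtype.ext (Prod.ext h1.symm h2.symm))
  · simp

lemma entry_arcFunctional_of_notMem {π : SetPartition n} (φ : π.arcs → Kˣ)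
    {i j : Fin n} (h : (i, j) ∉ π.arcs) : entry (arcFunctional π φ) i j = 0 := by
  rcases lt_or_ge i j with hij | hij
  · rw [entry, arcFunctional_apply, coe_strictSingle hij]
    refine Finset.sum_eq_zero fun b _ => ?_
    rw [Matrix.single_apply_of_ne, mul_zero]
    rintro ⟨h1, h2⟩
    apply h
    rw [h1, h2]
    exact b.2
  · exact entry_of_le _ hij

lemma entry_arcFunctional_ne_zero {π : SetPartition n} (φ : π.arcs → Kˣ)
    {i j : Fin n} : entry (arcFunctional π φ) i j ≠ 0 ↔ (i, j) ∈ π.arcs := by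
  refine ⟨fun h => by_contra fun h' => h (entry_arcFunctional_of_notMem φ h'), fun h => ?_⟩
  rw [entry_arcFunctional_of_mem π φ ⟨(i, j), h⟩]
  exact Units.ne_zero _

lemma arcFunctional_comp_rowScale (π : SetPartition n) (φ : π.arcs → Kˣ) (t : Fin n → Kˣ) :
    arcFunctional π φ ∘ₗ rowScale t = arcFunctional π fun a => φ a * t a.1.1 := by
  ext X
  simp [arcFunctional_apply, Matrix.diagonal_mul, mul_assoc]

open scoped Classical in
-- A row contains at most one arc, so its scaling factor can be chosen to correct the colour of that
-- arc; rows without an arc get the factor 1.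
lemma exists_rowScale (π : SetPartition n) (φ ψ : π.arcs → Kˣ) :
    ∃ t : Fin n → Kˣ, arcFunctional π φ ∘ₗ rowScale t = arcFunctional π ψ := by
  refine ⟨fun i => if h : ∃ j, (i, j) ∈ π.arcs then
    (φ ⟨_, h.choose_spec⟩)⁻¹ * ψ ⟨_, h.choose_spec⟩ else 1, ?_⟩
  rw [arcFunctional_comp_rowScale]
  congr 1
  funext a
  have h : ∃ j, (a.1.1, j) ∈ π.arcs := ⟨a.1.2, a.2⟩
  have e : (⟨_, h.choose_spec⟩ : π.arcs) = a :=
    Subtype.ext (Prod.ext rfl (SetPartition.arcs_right_unique h.choose_spec a.2))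
  simp only [dif_pos h]
  rw [e]
  simp

variable [Fintype K]

lemma mem_leftOrbit {l m : Module.Dual K (strictUpper K n)} :
    m ∈ leftOrbit l ↔ ∃ a, l ∘ₗ twoSidedMul a 1 = m := by
  simp [leftOrbit]

lemma mem_twoSidedOrbit {l m : Module.Dual K (strictUpper K n)} :
    m ∈ twoSidedOrbit l ↔ ∃ a b, l ∘ₗ twoSidedMul a b = m := by
  simp [twoSidedOrbit]

lemma self_mem_leftOrbit (l : Module.Dual K (strictUpper K n)) : l ∈ leftOrbit l :=
  mem_leftOrbit.2 ⟨1, by simp⟩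

lemma self_mem_twoSidedOrbit (l : Module.Dual K (strictUpper K n)) : l ∈ twoSidedOrbit l :=
  mem_twoSidedOrbit.2 ⟨1, 1, by simp⟩

lemma comp_twoSidedMul_mem {l m : Module.Dual K (strictUpper K n)} (a b : unitriangular K n) :
    m ∘ₗ twoSidedMul a b ∈ twoSidedOrbit l ↔ m ∈ twoSidedOrbit l := by
  simp only [mem_twoSidedOrbit]
  constructor
  · rintro ⟨c, d, h⟩
    refine ⟨c * a⁻¹, b⁻¹ * d, ?_⟩
    rw [← twoSidedMul_comp, ← LinearMap.comp_assoc, h, comp_twoSidedMul_inv]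
  · rintro ⟨c, d, rfl⟩
    exact ⟨c * a, b * d, by rw [← twoSidedMul_comp, LinearMap.comp_assoc]⟩

lemma twoSidedOrbit_comp_rowScale (l m : Module.Dual K (strictUpper K n)) (t : Fin n → Kˣ) :
    m ∘ₗ rowScale t ∈ twoSidedOrbit (l ∘ₗ rowScale t) ↔ m ∈ twoSidedOrbit l := by
  simp only [mem_twoSidedOrbit, LinearMap.comp_assoc, rowScale_comp_twoSidedMul]
  simp only [← LinearMap.comp_assoc, (comp_rowScale_injective t).eq_iff]
  constructor
  · rintro ⟨a, b, h⟩
    exact ⟨_, b, h⟩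
  · rintro ⟨a, b, h⟩
    exact ⟨diagConj t⁻¹ a, b, by rw [diagConj_diagConj_inv, h]⟩

lemma leftOrbit_comp_rowScale (l m : Module.Dual K (strictUpper K n)) (t : Fin n → Kˣ) :
    m ∘ₗ rowScale t ∈ leftOrbit (l ∘ₗ rowScale t) ↔ m ∈ leftOrbit l := by
  simp only [mem_leftOrbit, LinearMap.comp_assoc, rowScale_comp_twoSidedMul]
  simp only [← LinearMap.comp_assoc, (comp_rowScale_injective t).eq_iff]
  constructor
  · rintro ⟨a, h⟩
    exact ⟨_, h⟩
  · rintro ⟨a, h⟩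
    exact ⟨diagConj t⁻¹ a, by rw [diagConj_diagConj_inv, h]⟩

/-- Right composition with an invertible row scaling, as a permutation of the dual. -/
def rowScaleEquiv (t : Fin n → Kˣ) :
    Module.Dual K (strictUpper K n) ≃ Module.Dual K (strictUpper K n) where
  toFun l := l ∘ₗ rowScale t
  invFun l := l ∘ₗ rowScale t⁻¹
  left_inv l := comp_rowScale_inv l t
  right_inv l := by simpa using comp_rowScale_inv l t⁻¹

lemma card_twoSidedOrbit_comp_rowScale (l : Module.Dual K (strictUpper K n)) (t : Fin n → Kˣ) :
    (twoSidedOrbit (l ∘ₗ rowScale t)).card = (twoSidedOrbit l).card :=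
  (Finset.card_equiv (rowScaleEquiv t)
    fun m => (twoSidedOrbit_comp_rowScale l m t).symm).symm

lemma card_leftOrbit_comp_rowScale (l : Module.Dual K (strictUpper K n)) (t : Fin n → Kˣ) :
    (leftOrbit (l ∘ₗ rowScale t)).card = (leftOrbit l).card :=
  (Finset.card_equiv (rowScaleEquiv t)
    fun m => (leftOrbit_comp_rowScale l m t).symm).symm

open scoped Classical in
/-- The functionals in the two-sided orbit of `arcFunctional π φ` for some colouring `φ`. -/
noncomputable def arcClass (K : Type*) [Field K] [Fintype K] (π : SetPartition n) :
    Finset (Module.Dual K (strictUpper K n)) :=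
  Finset.univ.biUnion fun φ : π.arcs → Kˣ => twoSidedOrbit (arcFunctional π φ)

lemma mem_arcClass {π : SetPartition n} {m : Module.Dual K (strictUpper K n)} :
    m ∈ arcClass K π ↔ ∃ φ, m ∈ twoSidedOrbit (arcFunctional π φ) := by
  simp [arcClass]

lemma arcFunctional_mem_arcClass (π : SetPartition n) (φ : π.arcs → Kˣ) :
    arcFunctional π φ ∈ arcClass K π :=
  mem_arcClass.2 ⟨φ, self_mem_twoSidedOrbit _⟩

lemma arcClass_nonempty (π : SetPartition n) : (arcClass K π).Nonempty :=
  ⟨_, arcFunctional_mem_arcClass π 1⟩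

lemma comp_twoSidedMul_mem_arcClass {π : SetPartition n} {m : Module.Dual K (strictUpper K n)}
    (a b : unitriangular K n) : m ∘ₗ twoSidedMul a b ∈ arcClass K π ↔ m ∈ arcClass K π := by
  simp only [mem_arcClass, comp_twoSidedMul_mem]

lemma comp_rowScale_mem_arcClass {π : SetPartition n} {m : Module.Dual K (strictUpper K n)}
    (t : Fin n → Kˣ) : m ∘ₗ rowScale t ∈ arcClass K π ↔ m ∈ arcClass K π := by
  have key : ∀ (m : Module.Dual K (strictUpper K n)) (t : Fin n → Kˣ),
      m ∈ arcClass K π → m ∘ₗ rowScale t ∈ arcClass K π := by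
    intro m t h
    obtain ⟨φ, hφ⟩ := mem_arcClass.1 h
    refine mem_arcClass.2 ⟨fun a => φ a * t a.1.1, ?_⟩
    rwa [← arcFunctional_comp_rowScale, twoSidedOrbit_comp_rowScale]
  refine ⟨fun h => ?_, key m t⟩
  simpa only [comp_rowScale_inv] using key _ t⁻¹ h

/-- A property that is invariant under the unitriangular and diagonal actions holds on all of an
arc class if it holds at one point. -/
lemma arcClass_induction {π : SetPartition n} {p : Module.Dual K (strictUpper K n) → Prop}
    (hU : ∀ m a b, p m → p (m ∘ₗ twoSidedMul a b)) (hT : ∀ m t, p m → p (m ∘ₗ rowScale t))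
    {l m : Module.Dual K (strictUpper K n)} (hl : l ∈ arcClass K π) (hm : m ∈ arcClass K π)
    (h : p l) : p m := by
  obtain ⟨φ, hφ⟩ := mem_arcClass.1 hl
  obtain ⟨ψ, hψ⟩ := mem_arcClass.1 hm
  obtain ⟨a, b, rfl⟩ := mem_twoSidedOrbit.1 hφ
  obtain ⟨c, d, rfl⟩ := mem_twoSidedOrbit.1 hψ
  obtain ⟨t, ht⟩ := exists_rowScale π φ ψ
  rw [← ht]
  have := hU _ a⁻¹ b⁻¹ h
  rw [comp_twoSidedMul_inv] at this
  exact hU _ _ _ (hT _ _ this)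

/-! ### Expansion of supercharacters -/

open scoped Classical in
/-- The coefficient of `g ↦ θ (m (g - 1))` in the supercharacter of `π`. -/
noncomputable def superCoeff (π : SetPartition n) (m : Module.Dual K (strictUpper K n)) : ℝ :=
  ∑ φ : π.arcs → Kˣ, if m ∈ twoSidedOrbit (arcFunctional π φ) then
    ((leftOrbit (arcFunctional π φ)).card : ℝ) / ((twoSidedOrbit (arcFunctional π φ)).card : ℝ)
  else 0

lemma superCoeff_comp_twoSidedMul (π : SetPartition n) (m : Module.Dual K (strictUpper K n))
    (a b : unitriangular K n) : superCoeff π (m ∘ₗ twoSidedMul a b) = superCoeff π m := by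
  classical
  exact Finset.sum_congr rfl fun _ _ => if_congr (comp_twoSidedMul_mem a b) rfl rfl

lemma superCoeff_comp_rowScale (π : SetPartition n) (m : Module.Dual K (strictUpper K n))
    (t : Fin n → Kˣ) : superCoeff π (m ∘ₗ rowScale t) = superCoeff π m := by
  classical
  rw [superCoeff, superCoeff]
  refine (Fintype.sum_equiv (Equiv.mulRight fun a : π.arcs => t a.1.1) _ _ fun φ => ?_).symm
  have e : (Equiv.mulRight fun a : π.arcs => t a.1.1) φ = fun a => φ a * t a.1.1 := rfl
  rw [e, ← arcFunctional_comp_rowScale, card_leftOrbit_comp_rowScale,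
    card_twoSidedOrbit_comp_rowScale]
  simp only [twoSidedOrbit_comp_rowScale]

lemma superCoeff_pos {π : SetPartition n} {m : Module.Dual K (strictUpper K n)}
    (h : m ∈ arcClass K π) : 0 < superCoeff π m := by
  classical
  obtain ⟨φ, hφ⟩ := mem_arcClass.1 h
  refine Finset.sum_pos' (fun ψ _ => ?_) ⟨φ, Finset.mem_univ _, ?_⟩
  · split_ifs
    · positivity
    · exact le_rfl
  · rw [if_pos hφ]
    have h1 := Finset.card_pos.2 ⟨_, self_mem_leftOrbit (arcFunctional π φ)⟩
    have h2 := Finset.card_pos.2 ⟨_, self_mem_twoSidedOrbit (arcFunctional π φ)⟩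
    positivity

/-- The coefficient is invariant under the unitriangular and diagonal actions, which together are
transitive on an arc class. -/
lemma superCoeff_eq {π : SetPartition n} {l m : Module.Dual K (strictUpper K n)}
    (hl : l ∈ arcClass K π) (hm : m ∈ arcClass K π) : superCoeff π m = superCoeff π l :=
  arcClass_induction (p := fun m => superCoeff π m = superCoeff π l)
    (fun m a b h => by rw [superCoeff_comp_twoSidedMul, h])
    (fun m t h => by rw [superCoeff_comp_rowScale, h]) hl hm rfl

noncomputable instance : Fintype (Module.Dual K (strictUpper K n)) :=
  @Fintype.ofFinite _ (DFunLike.finite _)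

noncomputable instance : Fintype (strictUpper K n) := Fintype.ofFinite _

lemma supercharacter_eq_sum_superCoeff (θ : AddChar K ℂ) (π : SetPartition n)
    (g : unitriangular K n) :
    supercharacter θ π g = ∑ m ∈ arcClass K π, (superCoeff π m : ℂ) * θ (m (subOne g)) := by
  classical
  have e : ∀ φ : π.arcs → Kˣ, functionalSupercharacter θ (arcFunctional π φ) g =
      ∑ m, (if m ∈ twoSidedOrbit (arcFunctional π φ) then
        ((leftOrbit (arcFunctional π φ)).card : ℂ) / ((twoSidedOrbit (arcFunctional π φ)).card : ℂ)
        else 0) * θ (m (subOne g)) := by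
    intro φ
    rw [functionalSupercharacter, Finset.mul_sum]
    simp [ite_mul, Finset.sum_ite_mem]
  rw [supercharacter, Finset.sum_congr rfl fun φ _ => e φ, Finset.sum_comm]
  rw [← Finset.sum_subset (Finset.subset_univ (arcClass K π))]
  · refine Finset.sum_congr rfl fun m _ => ?_
    rw [superCoeff, ← Finset.sum_mul]
    push_cast
    refine congrArg (· * _) (Finset.sum_congr rfl fun φ _ => ?_)
    split_ifs <;> simp
  · intro m _ hm
    rw [← Finset.sum_mul]
    convert zero_mul _
    refine Finset.sum_eq_zero fun φ _ => if_neg fun hφ => hm (mem_arcClass.2 ⟨φ, hφ⟩)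

lemma exists_supercharacter_eq (θ : AddChar K ℂ) (π : SetPartition n) :
    ∃ c : ℝ, 0 < c ∧ ∀ g : unitriangular K n,
      supercharacter θ π g = c * ∑ m ∈ arcClass K π, θ (m (subOne g)) := by
  have h := arcFunctional_mem_arcClass π (1 : π.arcs → Kˣ)
  refine ⟨superCoeff π (arcFunctional π (1 : π.arcs → Kˣ)), superCoeff_pos h, fun g => ?_⟩
  rw [supercharacter_eq_sum_superCoeff, Finset.mul_sum]
  exact Finset.sum_congr rfl fun m hm => by rw [superCoeff_eq h hm]

end Classes

/-! ### Set partitions correspond to their arc sets. -/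

namespace SetPartition

variable {n : ℕ}

lemma part_eq_part_of_mem_arcs {π : SetPartition n} {i j : Fin n} (h : (i, j) ∈ π.arcs) :
    π.part i = π.part j := by
  obtain ⟨-, B, hB, hi, hj, -⟩ := mem_arcs.1 h
  rw [π.part_eq_of_mem hB hi, π.part_eq_of_mem hB hj]

lemma exists_mem_arcs_of_lt {π : SetPartition n} {i j : Fin n} (hij : i < j)
    (h : π.part i = π.part j) : ∃ p, i ≤ p ∧ (p, j) ∈ π.arcs := by
  classical
  have hne : ((π.part j).filter (· < j)).Nonempty :=
    ⟨i, Finset.mem_filter.2 ⟨h ▸ π.mem_part (Finset.mem_univ i), hij⟩⟩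
  have hp := Finset.mem_filter.1 (Finset.max'_mem _ hne)
  refine ⟨_, Finset.le_max' _ i (Finset.mem_filter.2
    ⟨h ▸ π.mem_part (Finset.mem_univ i), hij⟩), mem_arcs.2 ⟨hp.2, π.part j,
    π.part_mem.2 (Finset.mem_univ j), hp.1, π.mem_part (Finset.mem_univ j), ?_⟩⟩
  rintro k hk ⟨h1, h2⟩
  exact absurd (Finset.le_max' _ k (Finset.mem_filter.2 ⟨hk, h2⟩)) (not_le.2 h1)

/-- Going back from `j` along arcs of `π` leads to `i`, and each of these steps stays in one block
of `σ`. -/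
lemma part_eq_part_of_arcs_subset {π σ : SetPartition n} (h : π.arcs ⊆ σ.arcs) :
    ∀ j i : Fin n, i < j → π.part i = π.part j → σ.part i = σ.part j := by
  intro j
  induction j using WellFoundedLT.induction with
  | ind j ih =>
    intro i hij hp
    obtain ⟨p, hip, hpj⟩ := exists_mem_arcs_of_lt hij hp
    rw [← part_eq_part_of_mem_arcs (h hpj)]
    rcases hip.lt_or_eq with hip | rfl
    · exact ih p (lt_of_mem_arcs hpj) i hip (hp.trans (part_eq_part_of_mem_arcs hpj).symm)
    · rfl

lemma le_of_arcs_subset {π σ : SetPartition n} (h : π.arcs ⊆ σ.arcs) : π ≤ σ := by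
  intro B hB
  obtain ⟨i, hi⟩ := π.nonempty_of_mem_parts hB
  refine ⟨σ.part i, σ.part_mem.2 (Finset.mem_univ i), fun j hj => ?_⟩
  have e : π.part i = π.part j := by rw [π.part_eq_of_mem hB hi, π.part_eq_of_mem hB hj]
  have e' : σ.part i = σ.part j := by
    rcases lt_trichotomy i j with hij | rfl | hij
    · exact part_eq_part_of_arcs_subset h j i hij e
    · rfl
    · exact (part_eq_part_of_arcs_subset h i j hij e.symm).symm
  rw [e']
  exact σ.mem_part (Finset.mem_univ j)

lemma arcs_injective : Function.Injective (arcs : SetPartition n → Finset (Fin n × Fin n)) :=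
  fun _ _ h => le_antisymm (le_of_arcs_subset h.subset) (le_of_arcs_subset h.symm.subset)

open scoped Classical in
/-- The starting point of the chain through `j` of a relation contained in `<`. -/
noncomputable def chainRoot (A : Fin n → Fin n → Prop) (j : Fin n) : Fin n :=
  if h : ∃ i, A i j ∧ i < j then chainRoot A h.choose else j
termination_by j
decreasing_by exact h.choose_spec.2

lemma chainRoot_eq {A : Fin n → Fin n → Prop} (hlt : ∀ i j, A i j → i < j)
    (hl : ∀ i i' j, A i j → A i' j → i = i') {i j : Fin n} (h : A i j) : chainRoot A j = chainRoot A i := by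
  have h' : ∃ i, A i j ∧ i < j := ⟨i, h, hlt _ _ h⟩
  rw [chainRoot, dif_pos h', hl _ _ _ h'.choose_spec.1 h]

lemma chainRoot_le (A : Fin n → Fin n → Prop) (j : Fin n) : chainRoot A j ≤ j := by
  induction j using WellFoundedLT.induction with
  | ind j ih =>
    rw [chainRoot]
    split_ifs with h
    · exact (ih _ h.choose_spec.2).trans h.choose_spec.2.le
    · exact le_rfl

/-- Two points with the same root lie on one chain, so the smaller has a successor not beyond the
larger. The induction compares `i` with the predecessor `p` of `j`; `p < i` is impossible, as the
successor of `p` would be at most `i`, whereas it is `j`. -/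
lemma exists_next_of_chainRoot_eq {A : Fin n → Fin n → Prop} (hlt : ∀ i j, A i j → i < j)
    (hl : ∀ i i' j, A i j → A i' j → i = i')
    (hr : ∀ i j j', A i j → A i j' → j = j') : ∀ j i : Fin n, i < j → chainRoot A i = chainRoot A j →
    ∃ s, A i s ∧ s ≤ j := by
  intro j
  induction j using WellFoundedLT.induction with
  | ind j ih =>
    intro i hij h
    have h' : ∃ p, A p j := by
      by_contra hn
      have : chainRoot A j = j := by
        rw [chainRoot, dif_neg]
        rintro ⟨i, hi, -⟩
        exact hn ⟨i, hi⟩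
      rw [this] at h
      exact absurd (chainRoot_le A i) (not_le.2 (h ▸ hij))
    obtain ⟨p, hp⟩ := h'
    have hpr := chainRoot_eq hlt hl hp
    rcases lt_trichotomy i p with hip | rfl | hip
    · obtain ⟨s, hs, hsp⟩ := ih p (hlt _ _ hp) i hip (h.trans hpr)
      exact ⟨s, hs, hsp.trans (hlt _ _ hp).le⟩
    · exact ⟨j, hp, le_rfl⟩
    · obtain ⟨s, hs, hsi⟩ := ih i hij p hip (hpr.symm.trans h.symm)
      obtain rfl := hr _ _ _ hs hp
      exact absurd hsi (not_le.2 hij)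

lemma mem_arcs_iff_part {π : SetPartition n} {i j : Fin n} :
    (i, j) ∈ π.arcs ↔ i < j ∧ π.part i = π.part j ∧
      ∀ k, π.part k = π.part j → ¬ (i < k ∧ k < j) := by
  constructor
  · intro h
    refine ⟨lt_of_mem_arcs h, part_eq_part_of_mem_arcs h, ?_⟩
    obtain ⟨-, B, hB, hi, hj, hk⟩ := mem_arcs.1 h
    intro k e
    exact hk k (by rwa [← π.part_eq_iff_mem hB, e, π.part_eq_iff_mem hB])
  · rintro ⟨hij, e, hk⟩
    refine mem_arcs.2 ⟨hij, π.part j, π.part_mem.2 (Finset.mem_univ j), ?_,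
      π.mem_part (Finset.mem_univ j), fun k hkj => hk k ?_⟩
    · rw [← e]
      exact π.mem_part (Finset.mem_univ i)
    · exact (π.mem_part_iff_part_eq_part (Finset.mem_univ _) (Finset.mem_univ _)).1 hkj

/-- The blocks are the chains of `A`, that is, the fibres of `chainRoot A`. -/
lemma exists_arcs_eq {A : Fin n → Fin n → Prop} (hlt : ∀ i j, A i j → i < j)
    (hl : ∀ i i' j, A i j → A i' j → i = i')
    (hr : ∀ i j j', A i j → A i j' → j = j') :
    ∃ π : SetPartition n, ∀ i j, (i, j) ∈ π.arcs ↔ A i j := by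
  classical
  let π : SetPartition n := Finpartition.ofSetoid (Setoid.ker (chainRoot A))
  have hpart : ∀ i j, π.part i = π.part j ↔ chainRoot A i = chainRoot A j := by
    intro i j
    rw [← π.mem_part_iff_part_eq_part (Finset.mem_univ _) (Finset.mem_univ _),
      Finpartition.mem_part_ofSetoid_iff_rel]
    exact eq_comm
  refine ⟨π, fun i j => ?_⟩
  rw [mem_arcs_iff_part, hpart]
  simp only [hpart]
  constructor
  · rintro ⟨hij, e, hk⟩
    obtain ⟨s, hs, hsj⟩ := exists_next_of_chainRoot_eq hlt hl hr j i hij e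
    rcases hsj.lt_or_eq with h | rfl
    · exact absurd ⟨hlt _ _ hs, h⟩ (hk s ((chainRoot_eq hlt hl hs).trans e))
    · exact hs
  · intro h
    refine ⟨hlt _ _ h, (chainRoot_eq hlt hl h).symm, ?_⟩
    rintro k e ⟨hik, hkj⟩
    obtain ⟨s, hs, hsk⟩ := exists_next_of_chainRoot_eq hlt hl hr k i hik
      ((chainRoot_eq hlt hl h).symm.trans e.symm)
    obtain rfl := hr _ _ _ hs h
    exact absurd hsk (not_le.2 hkj)

end SetPartition

/-! ### Every functional lies in exactly one arc class. -/

section Classification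

variable {K : Type*} [Field K] {n : ℕ}

/-- Some row vector supported on the first rows up to `k`, nonzero at `k`, annihilates the columns
from `r` on of the matrix of entries of `m`. -/
def RowDependent (m : Module.Dual K (strictUpper K n)) (k : Fin n) (r : ℕ) : Prop :=
  ∃ y : Fin n → K, y k ≠ 0 ∧ (∀ i, k < i → y i = 0) ∧
    ∀ w : Fin n → K, (∀ j : Fin n, (j : ℕ) < r → w j = 0) →
      ∀ X : strictUpper K n, X.val = Matrix.vecMulVec y w → m X = 0

/-- On a rank-one matrix the action replaces `y` by `a y` and `w` by `w b`. Upper unitriangularity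
preserves the last nonzero coordinate of `y` and the vanishing of `w` before `r`, so `a⁻¹ y` is a
witness for the new functional. -/
lemma RowDependent.comp_twoSidedMul {m : Module.Dual K (strictUpper K n)} {k : Fin n} {r : ℕ}
    (h : RowDependent m k r) (a b : unitriangular K n) :
    RowDependent (m ∘ₗ twoSidedMul a b) k r := by
  obtain ⟨y, hk, hy, hm⟩ := h
  refine ⟨a⁻¹.val.val.mulVec y, ?_, ?_, ?_⟩
  · rw [Matrix.mulVec, dotProduct, Finset.sum_eq_single k]
    · rwa [a⁻¹.2.1 k, one_mul]
    · intro i _ hi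
      rcases lt_or_gt_of_ne hi with h | h
      · rw [a⁻¹.2.2 _ _ h, zero_mul]
      · rw [hy i h, mul_zero]
    · simp
  · intro l hl
    rw [Matrix.mulVec, dotProduct]
    refine Finset.sum_eq_zero fun i _ => ?_
    rcases lt_or_ge k i with h | h
    · rw [hy i h, mul_zero]
    · rw [a⁻¹.2.2 _ _ (h.trans_lt hl), zero_mul]
  · intro w hw X hX
    refine hm (Matrix.vecMul w b.val.val) (fun j hj => ?_) _ ?_
    · rw [Matrix.vecMul, dotProduct]
      refine Finset.sum_eq_zero fun i _ => ?_
      rcases lt_or_ge j i with h | h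
      · rw [b.2.2 _ _ h, mul_zero]
      · rw [hw i (lt_of_le_of_lt h hj), zero_mul]
    · rw [coe_twoSidedMul, hX, Matrix.mul_vecMulVec, Matrix.vecMulVec_mul, Matrix.mulVec_mulVec]
      simp

lemma RowDependent.comp_rowScale {m : Module.Dual K (strictUpper K n)} {k : Fin n} {r : ℕ}
    (h : RowDependent m k r) (t : Fin n → Kˣ) : RowDependent (m ∘ₗ rowScale t) k r := by
  obtain ⟨y, hk, hy, hm⟩ := h
  refine ⟨fun i => (t i : K)⁻¹ * y i, by simp [hk], fun i hi => by simp [hy i hi], ?_⟩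
  intro w hw X hX
  refine hm w hw _ ?_
  rw [coe_rowScale, hX]
  ext i j
  simp [Matrix.diagonal_mul, Matrix.vecMulVec_apply, mul_assoc]

/-- If `(k, j)` is an arc with `r ≤ j`, testing against the basis vector `w = e_j` leaves the single
term of that arc, a nonzero multiple of `y k`. If there is none, `y = e_k` works. The condition `k <
r` makes the test matrix strictly upper triangular. -/
lemma rowDependent_arcFunctional (π : SetPartition n) (φ : π.arcs → Kˣ) {k : Fin n} {r : ℕ}
    (hr : (k : ℕ) < r) :
    RowDependent (arcFunctional π φ) k r ↔ ∀ j, (k, j) ∈ π.arcs → (j : ℕ) < r := by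
  constructor
  · rintro ⟨y, hk, hy, hm⟩ j hj
    by_contra hrj
    rw [not_lt] at hrj
    have hX : Matrix.vecMulVec y (Pi.single j 1) ∈ strictUpper K n := by
      intro i l hl
      rw [Matrix.vecMulVec_apply]
      by_cases hlj : l = j
      · subst hlj
        rw [hy i (Fin.lt_def.2 (by have := Fin.le_def.1 hl; omega)), zero_mul]
      · simp [hlj]
    have h0 := hm (Pi.single j 1) (fun i hi => by
      rw [Pi.single_eq_of_ne]
      rintro rfl
      exact absurd hi (not_lt.2 hrj)) ⟨_, hX⟩ rfl
    rw [arcFunctional_apply, Finset.sum_eq_single ⟨(k, j), hj⟩] at h0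
    · simp [Matrix.vecMulVec_apply, hk] at h0
    · rintro ⟨⟨k', j'⟩, h'⟩ _ hne
      change _ * Matrix.vecMulVec y (Pi.single j 1) k' j' = 0
      rw [Matrix.vecMulVec_apply]
      by_cases hj' : j' = j
      · subst hj'
        obtain rfl := SetPartition.arcs_left_unique h' hj
        exact absurd rfl hne
      · simp [hj']
    · simp
  · intro h
    refine ⟨Pi.single k 1, by simp, fun i hi => by simp [hi.ne'], ?_⟩
    intro w hw X hX
    rw [arcFunctional_apply]
    refine Finset.sum_eq_zero ?_
    rintro ⟨⟨k', j⟩, h'⟩ _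
    rw [hX, Matrix.vecMulVec_apply]
    by_cases hk : k' = k
    · subst hk
      rw [hw j (h j h'), mul_zero, mul_zero]
    · simp [hk]

/-- The arc starting at `k` ends where row dependence first sets in, so the arcs are read off from a
quantity that is constant on arc classes. -/
lemma mem_arcs_iff_rowDependent (π : SetPartition n) (φ : π.arcs → Kˣ) {k j : Fin n} :
    (k, j) ∈ π.arcs ↔ k < j ∧ ¬ RowDependent (arcFunctional π φ) k j ∧
      RowDependent (arcFunctional π φ) k (j + 1) := by
  constructor
  · intro h
    have hkj : (k : ℕ) < j := SetPartition.lt_of_mem_arcs h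
    rw [rowDependent_arcFunctional π φ hkj, rowDependent_arcFunctional π φ (by omega)]
    refine ⟨hkj, fun h' => absurd (h' j h) (lt_irrefl _), fun j' hj' => ?_⟩
    rw [SetPartition.arcs_right_unique hj' h]
    omega
  · rintro ⟨hkj, h1, h2⟩
    have hkj' : (k : ℕ) < j := hkj
    rw [rowDependent_arcFunctional π φ hkj'] at h1
    rw [rowDependent_arcFunctional π φ (by omega)] at h2
    push Not at h1
    obtain ⟨j', hj', hle⟩ := h1
    have := h2 j' hj'
    have e : j' = j := Fin.ext (by omega)
    rwa [← e]

lemma RowDependent.of_mem_arcClass [Fintype K] {π : SetPartition n}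
    {l m : Module.Dual K (strictUpper K n)} (hl : l ∈ arcClass K π) (hm : m ∈ arcClass K π)
    {k : Fin n} {r : ℕ} (h : RowDependent l k r) : RowDependent m k r :=
  arcClass_induction (p := fun m => RowDependent m k r) (fun _ a b h => h.comp_twoSidedMul a b)
    (fun _ t h => h.comp_rowScale t) hl hm h

lemma eq_of_mem_arcClass [Fintype K] {π σ : SetPartition n}
    {m : Module.Dual K (strictUpper K n)} (hπ : m ∈ arcClass K π) (hσ : m ∈ arcClass K σ) :
    π = σ := by
  apply SetPartition.arcs_injective
  have h : ∀ k r, RowDependent (arcFunctional π (1 : π.arcs → Kˣ)) k r ↔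
      RowDependent (arcFunctional σ (1 : σ.arcs → Kˣ)) k r := fun k r =>
    ⟨fun h => .of_mem_arcClass hσ (arcFunctional_mem_arcClass σ 1)
      (.of_mem_arcClass (arcFunctional_mem_arcClass π 1) hπ h),
    fun h => .of_mem_arcClass hπ (arcFunctional_mem_arcClass π 1)
      (.of_mem_arcClass (arcFunctional_mem_arcClass σ 1) hσ h)⟩
  ext ⟨k, j⟩
  rw [mem_arcs_iff_rowDependent π (1 : π.arcs → Kˣ), mem_arcs_iff_rowDependent σ (1 : σ.arcs → Kˣ),
    h, h]

/-! ### Reduction to a partial permutation matrix -/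

/-- In each of the first `r` rows of the matrix of entries of `m` there is at most one nonzero
entry, and that entry is the only nonzero one in its column. -/
def ReducedUpTo (r : ℕ) (m : Module.Dual K (strictUpper K n)) : Prop :=
  ∀ i j : Fin n, (i : ℕ) < r → entry m i j ≠ 0 →
    (∀ j', j' ≠ j → entry m i j' = 0) ∧ ∀ i', i' ≠ i → entry m i' j = 0

/-- One round of elimination: `X` clears row `R` to the left of the pivot, `Y` clears the pivot
column below row `R`, and the rows already reduced are not disturbed. -/
lemma ReducedUpTo.exists_succ {r : ℕ} (hr : r < n) {m : Module.Dual K (strictUpper K n)}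
    (h : ReducedUpTo r m) :
    ∃ a b : unitriangular K n, ReducedUpTo (r + 1) (m ∘ₗ twoSidedMul a b) := by
  classical
  let R : Fin n := ⟨r, hr⟩
  by_cases h0 : ∀ j, entry m R j = 0
  · refine ⟨1, 1, ?_⟩
    rw [twoSidedMul_one_one, LinearMap.comp_id]
    intro i j hi hij
    refine h i j ?_ hij
    rcases (Nat.lt_succ_iff.1 hi).lt_or_eq with hi | hi
    · exact hi
    · exact absurd (h0 j) ((Fin.ext hi : i = R) ▸ hij)
  push Not at h0
  have hne : (Finset.univ.filter fun j => entry m R j ≠ 0).Nonempty := by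
    obtain ⟨j, hj⟩ := h0
    exact ⟨j, by simpa using hj⟩
  -- The pivot is the last nonzero entry of the row, because a column can only receive multiples of
  -- later columns.
  obtain ⟨j, hj, hmax⟩ : ∃ j, entry m R j ≠ 0 ∧ ∀ l, j < l → entry m R l = 0 := by
    refine ⟨_, (Finset.mem_filter.1 (Finset.max'_mem _ hne)).2, fun l hl => ?_⟩
    by_contra hl0
    exact absurd (Finset.le_max' _ l (Finset.mem_filter.2 ⟨Finset.mem_univ _, hl0⟩)) (not_le.2 hl)
  have hRj : R < j := by
    by_contra hle
    exact hj (entry_of_le m (not_lt.1 hle))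
  -- A nonzero entry here in a reduced row would be alone in its column, contradicting the pivot in
  -- row `R`.
  have hcol : ∀ k : Fin n, k < R → entry m k j = 0 := by
    intro k hk
    by_contra hkj
    exact hj ((h k j hk hkj).2 R hk.ne')
  let X : strictUpper K n := ⟨Matrix.of fun l j' =>
    if R < l ∧ l < j ∧ j' = j then -(entry m R l / entry m R j) else 0, by
      intro l j' hle
      rw [Matrix.of_apply, if_neg]
      rintro ⟨-, h1, rfl⟩
      exact absurd h1 (not_lt.2 hle)⟩
  let m₁ := m ∘ₗ twoSidedMul 1 (oneAdd X)
  have e₁ : ∀ k l, k < l → entry m₁ k l = entry m k l +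
      if R < l ∧ l < j then -(entry m k j * (entry m R l / entry m R j)) else 0 := by
    intro k l hkl
    rw [entry_comp_right m X hkl, Finset.sum_eq_single j]
    · simp only [X, Matrix.of_apply, and_true]
      split_ifs <;> ring
    · intro j' _ hj'
      simp [X, hj']
    · simp
  have hRow : ∀ k l, k < R → entry m₁ k l = entry m k l := by
    intro k l hk
    rcases lt_or_ge k l with hkl | hkl
    · rw [e₁ k l hkl, hcol k hk]
      simp
    · rw [entry_of_le _ hkl, entry_of_le _ hkl]
  have hR : ∀ l, l ≠ j → entry m₁ R l = 0 := by
    intro l hl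
    rcases lt_or_ge R l with hRl | hRl
    · rw [e₁ R l hRl]
      rcases lt_or_gt_of_ne hl with h1 | h1
      · rw [if_pos ⟨hRl, h1⟩]
        field_simp
        ring
      · rw [if_neg (fun h2 => absurd h2.2 h1.not_gt), hmax l h1, add_zero]
    · exact entry_of_le _ hRl
  have hCj : ∀ k, entry m₁ k j = entry m k j := by
    intro k
    rcases lt_or_ge k j with hkj | hkj
    · rw [e₁ k j hkj]
      simp
    · rw [entry_of_le _ hkj, entry_of_le _ hkj]
  let Y : strictUpper K n := ⟨Matrix.of fun i k =>
    if i = R ∧ R < k ∧ k < j then -(entry m k j / entry m R j) else 0, by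
      intro i k hle
      rw [Matrix.of_apply, if_neg]
      rintro ⟨rfl, h1, -⟩
      exact absurd h1 (not_lt.2 hle)⟩
  let m₂ := m₁ ∘ₗ twoSidedMul (oneAdd Y) 1
  have e₂ : ∀ k l, k < l → entry m₂ k l = entry m₁ k l +
      if R < k ∧ k < j then -(entry m k j / entry m R j) * entry m₁ R l else 0 := by
    intro k l hkl
    rw [entry_comp_left m₁ Y hkl, Finset.sum_eq_single R]
    · simp only [Y, Matrix.of_apply, true_and]
      split_ifs <;> ring
    · intro i _ hi
      simp [Y, hi]
    · simp
  have f₁ : ∀ k l, l ≠ j → entry m₂ k l = entry m₁ k l := by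
    intro k l hl
    rcases lt_or_ge k l with hkl | hkl
    · rw [e₂ k l hkl, hR l hl]
      simp
    · rw [entry_of_le _ hkl, entry_of_le _ hkl]
  have f₂ : ∀ k, k ≠ R → entry m₂ k j = 0 := by
    intro k hk
    rcases lt_or_ge k j with hkj | hkj
    · rw [e₂ k j hkj, hCj, hCj]
      rcases lt_or_gt_of_ne hk with h1 | h1
      · rw [if_neg (fun h2 => absurd h2.1 h1.not_gt), hcol k h1, add_zero]
      · rw [if_pos ⟨h1, hkj⟩]
        field_simp
        ring
    · exact entry_of_le _ hkj
  refine ⟨oneAdd Y, oneAdd X, ?_⟩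
  have em : m ∘ₗ twoSidedMul (oneAdd Y) (oneAdd X) = m₂ := by
    simp only [m₂, m₁, LinearMap.comp_assoc, twoSidedMul_comp, one_mul]
  rw [em]
  intro i l hi hil
  rcases (Nat.lt_succ_iff.1 hi).lt_or_eq with hi | hi
  · have hiR : i < R := hi
    have hlj : l ≠ j := by
      rintro rfl
      exact hil (f₂ i hiR.ne)
    rw [f₁ i l hlj, hRow i l hiR] at hil
    obtain ⟨h1, h2⟩ := h i l hi hil
    refine ⟨fun l' hl' => ?_, fun i' hi' => ?_⟩
    · by_cases hl'j : l' = j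
      · rw [hl'j]
        exact f₂ i hiR.ne
      · rw [f₁ i l' hl'j, hRow i l' hiR, h1 l' hl']
    · rw [f₁ i' l hlj]
      rcases lt_or_ge i' l with hil' | hil'
      · rw [e₁ i' l hil', h2 i' hi', h2 R hiR.ne']
        simp
      · exact entry_of_le _ hil'
  · obtain rfl : i = R := Fin.ext hi
    have hlj : l = j := by
      by_contra hlj
      rw [f₁ _ l hlj, hR l hlj] at hil
      exact hil rfl
    subst hlj
    exact ⟨fun l' hl' => by rw [f₁ _ l' hl', hR l' hl'], f₂⟩

lemma exists_reducedUpTo (m : Module.Dual K (strictUpper K n)) :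
    ∀ r ≤ n, ∃ a b : unitriangular K n, ReducedUpTo r (m ∘ₗ twoSidedMul a b) := by
  intro r
  induction r with
  | zero => exact fun _ => ⟨1, 1, fun i j hi => absurd hi (Nat.not_lt_zero _)⟩
  | succ r ih =>
    intro hr
    obtain ⟨a, b, h⟩ := ih (Nat.le_of_succ_le hr)
    obtain ⟨c, d, h'⟩ := h.exists_succ hr
    rw [LinearMap.comp_assoc, twoSidedMul_comp] at h'
    exact ⟨_, _, h'⟩

lemma ReducedUpTo.exists_eq_arcFunctional {m : Module.Dual K (strictUpper K n)}
    (h : ReducedUpTo n m) : ∃ (π : SetPartition n) (φ : π.arcs → Kˣ), m = arcFunctional π φ := by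
  obtain ⟨π, hπ⟩ := SetPartition.exists_arcs_eq (A := fun i j => entry m i j ≠ 0)
    (fun i j hij => by
      by_contra hle
      exact hij (entry_of_le m (not_lt.1 hle)))
    (fun i i' j h1 h2 => by
      by_contra hne
      exact h1 ((h i' j i'.2 h2).2 i hne))
    (fun i j j' h1 h2 => by
      by_contra hne
      exact h1 ((h i j' i.2 h2).1 j hne))
  refine ⟨π, fun a => Units.mk0 (entry m a.1.1 a.1.2) ((hπ _ _).1 a.2), dual_ext fun i j _ => ?_⟩
  by_cases hij : (i, j) ∈ π.arcs
  · rw [entry_arcFunctional_of_mem π _ ⟨(i, j), hij⟩]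
    rfl
  · rw [entry_arcFunctional_of_notMem _ hij]
    by_contra h0
    exact hij ((hπ _ _).2 h0)

lemma exists_mem_arcClass [Fintype K] (m : Module.Dual K (strictUpper K n)) :
    ∃ π : SetPartition n, m ∈ arcClass K π := by
  obtain ⟨a, b, h⟩ := exists_reducedUpTo m n le_rfl
  obtain ⟨π, φ, e⟩ := h.exists_eq_arcFunctional
  refine ⟨π, ?_⟩
  rw [← comp_twoSidedMul_mem_arcClass a b, e]
  exact arcFunctional_mem_arcClass π φ

/-- The set partition labelling the class of a functional. -/
noncomputable def arcType [Fintype K] (m : Module.Dual K (strictUpper K n)) : SetPartition n :=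
  (exists_mem_arcClass m).choose

lemma mem_arcClass_iff [Fintype K] {m : Module.Dual K (strictUpper K n)} {π : SetPartition n} :
    m ∈ arcClass K π ↔ arcType m = π :=
  ⟨eq_of_mem_arcClass (exists_mem_arcClass m).choose_spec,
    fun h => h ▸ (exists_mem_arcClass m).choose_spec⟩

end Classification

/-! ### Restriction of functionals from size `n + 1` to size `n`. -/

section Restriction

variable {K : Type*} [Field K] {n : ℕ}

/-- The inclusion of strictly upper triangular matrices that adds a zero row and a zero column. -/
def strictUpperSucc : strictUpper K n →ₗ[K] strictUpper K (n + 1) where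
  toFun X := ⟨(Matrix.fromBlocks X.val 0 0 (0 : Matrix (Fin 1) (Fin 1) K)).submatrix
      finSumFinEquiv.symm finSumFinEquiv.symm, by
    intro i j
    refine Fin.addCases (fun i => ?_) (fun i => ?_) i <;>
      refine Fin.addCases (fun j => ?_) (fun j => ?_) j <;> intro h
    · have := X.2 i j h
      simpa using this
    all_goals simp⟩
  map_add' X Y := by
    apply Subtype.ext
    ext i j
    refine Fin.addCases (fun i => ?_) (fun i => ?_) i <;>
      refine Fin.addCases (fun j => ?_) (fun j => ?_) j <;> simp
  map_smul' c X := by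
    apply Subtype.ext
    ext i j
    refine Fin.addCases (fun i => ?_) (fun i => ?_) i <;>
      refine Fin.addCases (fun j => ?_) (fun j => ?_) j <;> simp

lemma coe_strictUpperSucc (X : strictUpper K n) : (strictUpperSucc X).val =
    (Matrix.fromBlocks X.val 0 0 (0 : Matrix (Fin 1) (Fin 1) K)).submatrix
      finSumFinEquiv.symm finSumFinEquiv.symm := rfl

lemma coe_unitriangularSucc (g : unitriangular K n) : (unitriangularSucc g).val.val =
    (Matrix.fromBlocks g.val.val 0 0 (1 : Matrix (Fin 1) (Fin 1) K)).submatrix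
      finSumFinEquiv.symm finSumFinEquiv.symm := rfl

lemma subOne_unitriangularSucc (g : unitriangular K n) :
    subOne (unitriangularSucc g) = strictUpperSucc (subOne g) := by
  apply Subtype.ext
  change (unitriangularSucc g).val.val - 1 = _
  rw [coe_unitriangularSucc, coe_strictUpperSucc]
  change _ = (Matrix.fromBlocks (g.val.val - 1) 0 0 (0 : Matrix (Fin 1) (Fin 1) K)).submatrix _ _
  ext i j
  refine Fin.addCases (fun i => ?_) (fun i => ?_) i <;>
      refine Fin.addCases (fun j => ?_) (fun j => ?_) j
  · simp [Matrix.one_apply, Fin.ext_iff]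
  · simp [Fin.ext_iff, i.2.ne]
  · simp [Fin.ext_iff, j.2.ne']
  · simp [Subsingleton.elim i j]

lemma strictUpperSucc_comp_twoSidedMul (a b : unitriangular K n) :
    strictUpperSucc ∘ₗ twoSidedMul a b =
      twoSidedMul (unitriangularSucc a) (unitriangularSucc b) ∘ₗ strictUpperSucc := by
  apply LinearMap.ext
  intro X
  apply Subtype.ext
  simp only [LinearMap.comp_apply, coe_twoSidedMul, coe_strictUpperSucc, coe_unitriangularSucc,
    Matrix.submatrix_mul_equiv, Matrix.fromBlocks_multiply]
  simp

lemma strictUpperSucc_comp_rowScale (t : Fin n → Kˣ) :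
    strictUpperSucc ∘ₗ rowScale t = rowScale (Fin.snoc t 1) ∘ₗ strictUpperSucc := by
  apply LinearMap.ext
  intro X
  apply Subtype.ext
  ext i j
  have h : ∀ i : Fin n, (Fin.snoc t 1 : Fin (n + 1) → Kˣ) (Fin.castAdd 1 i) = t i :=
    fun i => Fin.snoc_castSucc (α := fun _ => Kˣ) 1 t i
  refine Fin.addCases (fun i => ?_) (fun i => ?_) i <;>
      refine Fin.addCases (fun j => ?_) (fun j => ?_) j <;>
      simp [coe_strictUpperSucc, Matrix.diagonal_mul, h]

lemma strictUpperSucc_apply_castSucc (X : strictUpper K n) (i j : Fin n) :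
    (strictUpperSucc X).val i.castSucc j.castSucc = X.val i j := by
  change (Matrix.fromBlocks X.val 0 0 (0 : Matrix (Fin 1) (Fin 1) K)).submatrix
      finSumFinEquiv.symm finSumFinEquiv.symm (Fin.castAdd 1 i) (Fin.castAdd 1 j) = _
  simp

lemma strictUpperSucc_apply_last_left (X : strictUpper K n) (j : Fin (n + 1)) :
    (strictUpperSucc X).val (Fin.last n) j = 0 :=
  (strictUpperSucc X).2 _ _ (Fin.le_last j)

lemma strictUpperSucc_apply_last_right (X : strictUpper K n) (i : Fin (n + 1)) :
    (strictUpperSucc X).val i (Fin.last n) = 0 := by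
  change (Matrix.fromBlocks X.val 0 0 (0 : Matrix (Fin 1) (Fin 1) K)).submatrix
      finSumFinEquiv.symm finSumFinEquiv.symm _ (Fin.natAdd n 0) = _
  refine Fin.addCases (fun i => ?_) (fun i => ?_) i <;> simp

variable [Fintype K]

open scoped Classical in
/-- The functionals in the class of `σ` that restrict to the functional `l`. -/
noncomputable def extensions (σ : SetPartition (n + 1)) (l : Module.Dual K (strictUpper K n)) :
    Finset (Module.Dual K (strictUpper K (n + 1))) :=
  (arcClass K σ).filter fun m => m ∘ₗ strictUpperSucc = l

/-- A symmetry `g` of the small dual that lifts to a symmetry `f` of the class of `σ` maps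
extensions to extensions. Applied to the actions and their inverses, it makes the count depend on
the class of `l` only. -/
lemma card_extensions_le (σ : SetPartition (n + 1)) (l : Module.Dual K (strictUpper K n))
    {f : Module.Dual K (strictUpper K (n + 1)) → Module.Dual K (strictUpper K (n + 1))}
    {g : Module.Dual K (strictUpper K n) → Module.Dual K (strictUpper K n)}
    (hf : Function.Injective f) (hσ : ∀ m ∈ arcClass K σ, f m ∈ arcClass K σ)
    (hg : ∀ m, f m ∘ₗ strictUpperSucc = g (m ∘ₗ strictUpperSucc)) :
    (extensions σ l).card ≤ (extensions σ (g l)).card := by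
  classical
  refine Finset.card_le_card_of_injOn f (fun m hm => ?_) hf.injOn
  obtain ⟨h1, h2⟩ := Finset.mem_filter.1 hm
  exact Finset.mem_filter.2 ⟨hσ m h1, by rw [hg, h2]⟩

lemma card_extensions_twoSidedMul (σ : SetPartition (n + 1))
    (l : Module.Dual K (strictUpper K n)) (a b : unitriangular K n) :
    (extensions σ (l ∘ₗ twoSidedMul a b)).card = (extensions σ l).card := by
  have key : ∀ (l : Module.Dual K (strictUpper K n)) (a b : unitriangular K n),
      (extensions σ l).card ≤ (extensions σ (l ∘ₗ twoSidedMul a b)).card := fun l a b =>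
    card_extensions_le σ l
      (f := (· ∘ₗ twoSidedMul (unitriangularSucc a) (unitriangularSucc b)))
      (g := (· ∘ₗ twoSidedMul a b))
      (fun m m' h => by
        have := congrArg (· ∘ₗ twoSidedMul (unitriangularSucc a)⁻¹ (unitriangularSucc b)⁻¹) h
        simpa only [comp_twoSidedMul_inv] using this)
      (fun m hm => (comp_twoSidedMul_mem_arcClass _ _).2 hm)
      (fun m => by
        rw [LinearMap.comp_assoc, ← strictUpperSucc_comp_twoSidedMul, LinearMap.comp_assoc])
  refine le_antisymm ?_ (key l a b)
  simpa only [comp_twoSidedMul_inv] using key (l ∘ₗ twoSidedMul a b) a⁻¹ b⁻¹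

lemma card_extensions_rowScale (σ : SetPartition (n + 1))
    (l : Module.Dual K (strictUpper K n)) (t : Fin n → Kˣ) :
    (extensions σ (l ∘ₗ rowScale t)).card = (extensions σ l).card := by
  have key : ∀ (l : Module.Dual K (strictUpper K n)) (t : Fin n → Kˣ),
      (extensions σ l).card ≤ (extensions σ (l ∘ₗ rowScale t)).card := fun l t =>
    card_extensions_le σ l (f := (· ∘ₗ rowScale (Fin.snoc t 1))) (g := (· ∘ₗ rowScale t))
      (comp_rowScale_injective _)
      (fun m hm => (comp_rowScale_mem_arcClass _).2 hm)
      (fun m => by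
        rw [LinearMap.comp_assoc, ← strictUpperSucc_comp_rowScale, LinearMap.comp_assoc])
  refine le_antisymm ?_ (key l t)
  simpa only [comp_rowScale_inv] using key (l ∘ₗ rowScale t) t⁻¹

/-- The number of extensions in the class of `σ` of a functional in the class of `π`. -/
noncomputable def extensionCount (K : Type*) [Field K] [Fintype K] (π : SetPartition n)
    (σ : SetPartition (n + 1)) : ℕ :=
  (extensions σ (arcFunctional π (1 : π.arcs → Kˣ))).card

lemma card_extensions {π : SetPartition n} {l : Module.Dual K (strictUpper K n)}
    (hl : l ∈ arcClass K π) (σ : SetPartition (n + 1)) :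
    (extensions σ l).card = extensionCount K π σ :=
  arcClass_induction (p := fun l => (extensions σ l).card = extensionCount K π σ)
    (fun l a b h => by rw [card_extensions_twoSidedMul, h])
    (fun l t h => by rw [card_extensions_rowScale, h]) (arcFunctional_mem_arcClass π 1) hl rfl

open scoped Classical in
-- Every fibre over `S` has the same size. Taking `S` to be the whole class computes edge
-- multiplicities; taking a smaller `S` counts functionals along a whole path.
lemma card_filter_restrict {π : SetPartition n} {S : Finset (Module.Dual K (strictUpper K n))}
    (hS : S ⊆ arcClass K π) (σ : SetPartition (n + 1)) :
    ((arcClass K σ).filter fun m => m ∘ₗ strictUpperSucc ∈ S).card =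
      S.card * extensionCount K π σ := by
  refine (Finset.card_eq_sum_card_fiberwise (t := S)
    (f := fun m : Module.Dual K (strictUpper K (n + 1)) => m ∘ₗ strictUpperSucc)
    fun m hm => (Finset.mem_filter.1 (Finset.mem_coe.1 hm)).2).trans ?_
  rw [← smul_eq_mul, ← Finset.sum_const]
  refine Finset.sum_congr rfl fun l hl => ?_
  rw [← card_extensions (hS hl) σ, extensions, Finset.filter_filter]
  congr 1
  ext m
  simp only [Finset.mem_filter]
  constructor
  · rintro ⟨h, -, h'⟩
    exact ⟨h, h'⟩
  · rintro ⟨h, rfl⟩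
    exact ⟨h, hl, rfl⟩

end Restriction

/-! ### Orthogonality; superplancherel weights and transitions as counts. -/

section InnerProducts

variable {K : Type*} [Field K] [Fintype K] {n : ℕ}

lemma sum_addChar_comp_dual {θ : AddChar K ℂ} (hθ : θ ≠ 1) {m : Module.Dual K (strictUpper K n)}
    (hm : m ≠ 0) : ∑ g : unitriangular K n, θ (m (subOne g)) = 0 := by
  rw [subOne_bijective.sum_comp fun X => θ (m X)]
  have h : θ.compAddMonoidHom m.toAddMonoidHom ≠ 1 := by
    obtain ⟨x, hx⟩ := AddChar.ne_one_iff.1 hθ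
    obtain ⟨X, rfl⟩ := LinearMap.surjective hm x
    exact AddChar.ne_one_iff.2 ⟨X, hx⟩
  simpa using AddChar.sum_eq_zero_of_ne_one h

lemma charInner_addChar {θ : AddChar K ℂ} (hθ : θ ≠ 1) (l m : Module.Dual K (strictUpper K n)) :
    (Fintype.card (unitriangular K n) : ℂ)⁻¹ *
      ∑ g : unitriangular K n, (starRingEnd ℂ) (θ (l (subOne g))) * θ (m (subOne g)) =
      open scoped Classical in if m = l then 1 else 0 := by
  have e : ∀ g : unitriangular K n,
      (starRingEnd ℂ) (θ (l (subOne g))) * θ (m (subOne g)) = θ ((m - l) (subOne g)) := by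
    intro g
    rw [← AddChar.map_neg_eq_conj, ← AddChar.map_add_eq_mul]
    congr 1
    simp
    ring
  rw [Finset.sum_congr rfl fun g _ => e g]
  split_ifs with h
  · subst h
    simp
  · rw [sum_addChar_comp_dual hθ (sub_ne_zero.2 h), mul_zero]

open scoped Classical in
-- The second sum runs over an indexed family, since distinct functionals of size `n + 1` may have
-- the same restriction and must be counted with multiplicity.
lemma charInner_sum {ι : Type*} {θ : AddChar K ℂ} (hθ : θ ≠ 1) (c d : ℝ)
    (A : Finset (Module.Dual K (strictUpper K n))) (B : Finset ι)
    (f : ι → Module.Dual K (strictUpper K n)) :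
    charInner (fun g : unitriangular K n => (c : ℂ) * ∑ l ∈ A, θ (l (subOne g)))
      (fun g => (d : ℂ) * ∑ i ∈ B, θ (f i (subOne g))) =
      c * d * ((B.filter fun i => f i ∈ A).card : ℂ) := by
  have e : ∀ g : unitriangular K n,
      (starRingEnd ℂ) ((c : ℂ) * ∑ l ∈ A, θ (l (subOne g))) *
        ((d : ℂ) * ∑ i ∈ B, θ (f i (subOne g))) =
      ∑ i ∈ B, ∑ l ∈ A,
        (c * d : ℂ) * ((starRingEnd ℂ) (θ (l (subOne g))) * θ (f i (subOne g))) := by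
    intro g
    rw [map_mul, map_sum, Complex.conj_ofReal, mul_mul_mul_comm, Finset.sum_mul_sum,
      Finset.sum_comm, Finset.mul_sum]
    simp only [Finset.mul_sum]
  rw [charInner, Finset.sum_congr rfl fun g _ => e g, Finset.sum_comm, Finset.mul_sum,
    Finset.card_filter, Nat.cast_sum, Finset.mul_sum]
  refine Finset.sum_congr rfl fun i _ => ?_
  rw [Finset.sum_comm, Finset.mul_sum]
  have : ∀ l ∈ A, (Fintype.card (unitriangular K n) : ℂ)⁻¹ * ∑ g : unitriangular K n,
      (c * d : ℂ) * ((starRingEnd ℂ) (θ (l (subOne g))) * θ (f i (subOne g))) =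
      c * d * if f i = l then 1 else 0 := by
    intro l _
    rw [← Finset.mul_sum, mul_left_comm, charInner_addChar hθ]
  rw [Finset.sum_congr rfl this, ← Finset.mul_sum, Finset.sum_ite_eq]
  push_cast
  rfl

lemma exists_supercharacter_formulas {θ : AddChar K ℂ} (hθ : θ ≠ 1) (π : SetPartition n) :
    ∃ c : ℝ, 0 < c ∧ (supercharacter θ π = fun g => (c : ℂ) * ∑ m ∈ arcClass K π, θ (m (subOne g)))
      ∧ supercharacter θ π 1 = c * (arcClass K π).card ∧
      charInner (supercharacter θ π) (supercharacter θ π) = c * c * (arcClass K π).card := by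
  obtain ⟨c, hc, h⟩ := exists_supercharacter_eq θ π
  have h' := funext h
  refine ⟨c, hc, h', ?_, ?_⟩
  · rw [h 1]
    simp
  · classical
    rw [h', charInner_sum hθ c c (arcClass K π) (arcClass K π) fun m => m]
    simp

lemma superPlancherel_eq {θ : AddChar K ℂ} (hθ : θ ≠ 1) (π : SetPartition n) :
    superPlancherel θ π = (arcClass K π).card / Fintype.card (unitriangular K n) := by
  obtain ⟨c, hc, -, h1, h2⟩ := exists_supercharacter_formulas hθ π
  have hc' : (c : ℂ) ≠ 0 := by exact_mod_cast hc.ne'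
  have hO : ((arcClass K π).card : ℂ) ≠ 0 := by
    exact_mod_cast (Finset.card_pos.2 (arcClass_nonempty π)).ne'
  rw [superPlancherel, superPlancherelWeight, h1, h2]
  field_simp

/-- The degrees are given with the same constants `c` and `d`, so that these cancel in
`transition_eq`. -/
lemma exists_edgeMultiplicity_eq {θ : AddChar K ℂ} (hθ : θ ≠ 1) (π : SetPartition n)
    (σ : SetPartition (n + 1)) :
    ∃ c d : ℝ, 0 < c ∧ 0 < d ∧ supercharacter θ π 1 = c * (arcClass K π).card ∧
      supercharacter θ σ 1 = d * (arcClass K σ).card ∧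
      edgeMultiplicity θ π σ = d / c * extensionCount K π σ := by
  classical
  obtain ⟨c, hc, h, h1, h2⟩ := exists_supercharacter_formulas hθ π
  obtain ⟨d, hd, h', h1', -⟩ := exists_supercharacter_formulas hθ σ
  refine ⟨c, d, hc, hd, h1, h1', ?_⟩
  have hc' : (c : ℂ) ≠ 0 := by exact_mod_cast hc.ne'
  have hO : ((arcClass K π).card : ℂ) ≠ 0 := by
    exact_mod_cast (Finset.card_pos.2 (arcClass_nonempty π)).ne'
  have e : (fun g => supercharacter θ σ (unitriangularSucc g)) = fun g : unitriangular K n =>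
      (d : ℂ) * ∑ m ∈ arcClass K σ, θ ((m ∘ₗ strictUpperSucc) (subOne g)) := by
    funext g
    simp only [h', subOne_unitriangularSucc]
    rfl
  rw [edgeMultiplicity, h2, e, h, charInner_sum hθ c d (arcClass K π) (arcClass K σ)
    (fun m => m ∘ₗ strictUpperSucc), card_filter_restrict subset_rfl]
  push_cast
  field_simp

lemma edgeMultiplicity_ne_zero_iff {θ : AddChar K ℂ} (hθ : θ ≠ 1) (π : SetPartition n)
    (σ : SetPartition (n + 1)) : edgeMultiplicity θ π σ ≠ 0 ↔ extensionCount K π σ ≠ 0 := by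
  obtain ⟨c, d, hc, hd, -, -, h⟩ := exists_edgeMultiplicity_eq hθ π σ
  rw [h]
  simp [hc.ne', hd.ne']

lemma transition_eq {θ : AddChar K ℂ} (hθ : θ ≠ 1) (π : SetPartition n)
    (σ : SetPartition (n + 1)) :
    transition θ π σ = extensionCount K π σ * Fintype.card (unitriangular K n) /
      Fintype.card (unitriangular K (n + 1)) := by
  obtain ⟨c, d, hc, hd, h1, h2, h⟩ := exists_edgeMultiplicity_eq hθ π σ
  have hc' : (c : ℂ) ≠ 0 := by exact_mod_cast hc.ne'
  have hd' : (d : ℂ) ≠ 0 := by exact_mod_cast hd.ne'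
  have hO : ((arcClass K π).card : ℂ) ≠ 0 := by
    exact_mod_cast (Finset.card_pos.2 (arcClass_nonempty π)).ne'
  have hO' : ((arcClass K σ).card : ℂ) ≠ 0 := by
    exact_mod_cast (Finset.card_pos.2 (arcClass_nonempty σ)).ne'
  rw [transition, h1, h2, h, superPlancherel_eq hθ, superPlancherel_eq hθ]
  field_simp

end InnerProducts

/-! ### Sizes of the dual and of the group. -/

section Cardinalities

variable {K : Type*} [Field K] [Fintype K] {n : ℕ}

/-- The positions strictly above the diagonal. -/
def upperPairs (n : ℕ) : Finset (Fin n × Fin n) :=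
  Finset.univ.filter fun p => p.1 < p.2

lemma mem_upperPairs {i j : Fin n} : (i, j) ∈ upperPairs n ↔ i < j := by
  simp [upperPairs]

/-- A functional is determined by its entries, which are arbitrary. -/
noncomputable def dualEquiv : Module.Dual K (strictUpper K n) ≃ (upperPairs n → K) where
  toFun m p := entry m p.1.1 p.1.2
  invFun C := ofEntries fun i j => if h : (i, j) ∈ upperPairs n then C ⟨(i, j), h⟩ else 0
  left_inv m := dual_ext fun i j hij => by
    rw [entry_ofEntries _ hij, dif_pos (mem_upperPairs.2 hij)]
  right_inv C := by
    funext p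
    change entry (ofEntries _) p.1.1 p.1.2 = C p
    rw [entry_ofEntries _ (mem_upperPairs.1 p.2), dif_pos p.2]

lemma card_dual : Fintype.card (Module.Dual K (strictUpper K n)) =
    Fintype.card K ^ (upperPairs n).card := by
  classical
  rw [Fintype.card_congr dualEquiv]
  simp

lemma card_unitriangular : Fintype.card (unitriangular K n) =
    Fintype.card K ^ (upperPairs n).card := by
  rw [← card_dual, Fintype.card_of_bijective subOne_bijective, ← Nat.card_eq_fintype_card,
    ← Nat.card_eq_fintype_card, Module.natCard_eq_pow_finrank (K := K),
    Module.natCard_eq_pow_finrank (K := K) (V := Module.Dual K _), Subspace.dual_finrank_eq]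

lemma two_mul_card_upperPairs (n : ℕ) : 2 * (upperPairs n).card + n = n ^ 2 := by
  have h1 : (upperPairs n).card = (Finset.univ.filter fun p : Fin n × Fin n => p.2 < p.1).card :=
    Finset.card_equiv (Equiv.prodComm _ _) fun p => by simp [upperPairs]
  have h2 : (Finset.univ.filter fun p : Fin n × Fin n => p.1 = p.2).card = n := by
    have h : (Finset.univ : Finset (Fin n)).card = n := by simp
    refine Eq.trans ?_ h
    refine Finset.card_bij' (fun p _ => p.1) (fun i _ => (i, i)) ?_ ?_ ?_ ?_ <;>
      simp +contextual [Prod.ext_iff]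
  have h3 : (upperPairs n).card + ((Finset.univ.filter fun p : Fin n × Fin n => p.2 < p.1).card +
      (Finset.univ.filter fun p : Fin n × Fin n => p.1 = p.2).card) = n ^ 2 := by
    rw [upperPairs, ← Finset.card_union_of_disjoint, ← Finset.card_union_of_disjoint]
    · have h : (Finset.univ : Finset (Fin n × Fin n)).card = n ^ 2 := by simp [sq]
      refine Eq.trans (congrArg Finset.card ?_) h
      ext p
      simp only [Finset.mem_union, Finset.mem_filter, Finset.mem_univ, true_and, iff_true]
      rcases lt_trichotomy p.1 p.2 with h | h | h <;> simp [h]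
    · rw [Finset.disjoint_left]
      intro p
      simp only [Finset.mem_union, Finset.mem_filter, Finset.mem_univ, true_and]
      omega
    · rw [Finset.disjoint_left]
      intro p
      simp only [Finset.mem_filter, Finset.mem_univ, true_and]
      omega
  omega

end Cardinalities

/-! ### Uniform random arrays and the types of their corners. -/

section RandomArray

variable {K : Type*} [Field K]

/-- The functional with entries the top left corner of an infinite array. -/
noncomputable def cornerFunctional (ω : ℕ × ℕ → K) (n : ℕ) : Module.Dual K (strictUpper K n) :=
  ofEntries fun i j => ω (i, j)

lemma cornerFunctional_succ (ω : ℕ × ℕ → K) (n : ℕ) :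
    cornerFunctional ω (n + 1) ∘ₗ strictUpperSucc = cornerFunctional ω n := by
  ext X
  simp only [cornerFunctional, ofEntries, LinearMap.comp_apply, LinearMap.coe_mk, AddHom.coe_mk,
    Fin.sum_univ_castSucc, strictUpperSucc_apply_castSucc, strictUpperSucc_apply_last_left,
    strictUpperSucc_apply_last_right]
  simp

variable [Fintype K]

open scoped Classical in
/-- The functionals of size `N` whose successive restrictions lie in the classes of `γ`. -/
noncomputable def pathClass (K : Type*) [Field K] [Fintype K] (γ : ∀ n : ℕ, SetPartition n) :
    ∀ N : ℕ, Finset (Module.Dual K (strictUpper K N))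
  | 0 => arcClass K (γ 0)
  | N + 1 => (arcClass K (γ (N + 1))).filter fun m => m ∘ₗ strictUpperSucc ∈ pathClass K γ N

lemma pathClass_subset (γ : ∀ n : ℕ, SetPartition n) (N : ℕ) :
    pathClass K γ N ⊆ arcClass K (γ N) := by
  classical
  cases N with
  | zero => exact subset_rfl
  | succ N => exact Finset.filter_subset _ _

lemma card_pathClass_zero (γ : ∀ n : ℕ, SetPartition n) : (pathClass K γ 0).card = 1 := by
  refine le_antisymm (Finset.card_le_one.2 fun l _ m _ => ?_)
    (Finset.card_pos.2 (arcClass_nonempty _))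
  exact dual_ext fun i => i.elim0

lemma card_pathClass_succ (γ : ∀ n : ℕ, SetPartition n) (N : ℕ) :
    (pathClass K γ (N + 1)).card =
      (pathClass K γ N).card * extensionCount K (γ N) (γ (N + 1)) :=
  card_filter_restrict (pathClass_subset γ N) _

/-- The group orders telescope, and the extension counts multiply up to the number of functionals
following the path. -/
lemma prod_transition {θ : AddChar K ℂ} (hθ : θ ≠ 1) (γ : ∀ n : ℕ, SetPartition n) (N : ℕ) :
    ∏ n ∈ Finset.range N, transition θ (γ n) (γ (n + 1)) =
      (pathClass K γ N).card / Fintype.card (unitriangular K N) := by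
  induction N with
  | zero => simp [card_pathClass_zero, card_unitriangular, upperPairs]
  | succ N ih =>
    have h : (Fintype.card (unitriangular K N) : ℂ) ≠ 0 := by
      exact_mod_cast Fintype.card_ne_zero
    rw [Finset.prod_range_succ, ih, transition_eq hθ, card_pathClass_succ]
    push_cast
    field_simp

lemma cornerFunctional_mem_pathClass (ω : ℕ × ℕ → K) (γ : ∀ n : ℕ, SetPartition n) (N : ℕ) :
    cornerFunctional ω N ∈ pathClass K γ N ↔
      ∀ n ≤ N, arcType (cornerFunctional ω n) = γ n := by
  induction N with
  | zero => simp [pathClass, mem_arcClass_iff]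
  | succ N ih =>
    simp only [pathClass, Finset.mem_filter, cornerFunctional_succ, ih, mem_arcClass_iff,
      Nat.le_succ_iff]
    constructor
    · rintro ⟨h1, h2⟩ n (hn | rfl)
      · exact h2 n hn
      · exact h1
    · exact fun h => ⟨h _ (Or.inr rfl), fun n hn => h n (Or.inl hn)⟩

variable [MeasurableSpace K] [MeasurableSingletonClass K]

/-- The law of an infinite array of independent uniform elements of `K`. -/
noncomputable def arrayMeasure (K : Type*) [Field K] [Fintype K] [MeasurableSpace K] :
    Measure (ℕ × ℕ → K) :=
  Measure.infinitePi fun _ => (PMF.uniformOfFintype K).toMeasure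

instance : IsProbabilityMeasure (arrayMeasure K) := by
  unfold arrayMeasure
  infer_instance

lemma measurable_comp_cornerFunctional {α : Type*} [MeasurableSpace α] (n : ℕ)
    (f : Module.Dual K (strictUpper K n) → α) :
    Measurable fun ω : ℕ × ℕ → K => f (cornerFunctional ω n) := by
  have h : Measurable fun (ω : ℕ × ℕ → K) (p : Fin n × Fin n) => ω (p.1, p.2) :=
    measurable_pi_lambda _ fun p => measurable_pi_apply _
  let F : (Fin n × Fin n → K) → α := fun C => f (ofEntries fun i j => C (i, j))
  have hF : Measurable F := by
    intro s _
    exact (Set.toFinite _).measurableSet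
  have e : (fun ω : ℕ × ℕ → K => f (cornerFunctional ω n)) =
    F ∘ fun (ω : ℕ × ℕ → K) (p : Fin n × Fin n) => ω (p.1, p.2) := rfl
  rw [e]
  exact hF.comp h

lemma arrayMeasure_cornerFunctional_eq {n : ℕ} (m : Module.Dual K (strictUpper K n)) :
    (arrayMeasure K).real {ω | cornerFunctional ω n = m} =
      1 / Fintype.card (unitriangular K n) := by
  classical
  let e : Fin n × Fin n ↪ ℕ × ℕ := Fin.valEmbedding.prodMap Fin.valEmbedding
  -- The value `∅` is irrelevant: only positions coming from `upperPairs n` are constrained.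
  let t : ℕ × ℕ → Set K := fun p =>
    if h : p.1 < n ∧ p.2 < n then {entry m ⟨p.1, h.1⟩ ⟨p.2, h.2⟩} else ∅
  have hset : {ω : ℕ × ℕ → K | cornerFunctional ω n = m} =
      Set.pi ((upperPairs n).map e) t := by
    ext ω
    simp only [Set.mem_ofPred_eq, Set.mem_pi, Finset.mem_coe, Finset.mem_map]
    constructor
    · rintro rfl _ ⟨⟨i, j⟩, hij, rfl⟩
      have : e (i, j) = ((i : ℕ), (j : ℕ)) := rfl
      simp [t, this, cornerFunctional, entry_ofEntries _ (mem_upperPairs.1 hij)]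
    · intro h
      refine dual_ext fun i j hij => ?_
      have := h _ ⟨(i, j), mem_upperPairs.2 hij, rfl⟩
      have he : e (i, j) = ((i : ℕ), (j : ℕ)) := rfl
      simpa [t, he, cornerFunctional, entry_ofEntries _ hij] using this
  have ht : ∀ p, MeasurableSet (t p) := fun p => (Set.toFinite (t p)).measurableSet
  rw [hset, measureReal_def, arrayMeasure, Measure.infinitePi_pi _ fun p _ => ht p,
    Finset.prod_map, card_unitriangular, Finset.prod_congr rfl (g := fun _ =>
      ((Fintype.card K : ENNReal))⁻¹), Finset.prod_const]
  · simp
  · rintro ⟨i, j⟩ -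
    have he : e (i, j) = ((i : ℕ), (j : ℕ)) := rfl
    rw [PMF.toMeasure_uniformOfFintype_apply _ (ht _)]
    simp [t, he]

lemma arrayMeasure_cornerFunctional_mem {n : ℕ} (S : Finset (Module.Dual K (strictUpper K n))) :
    (arrayMeasure K).real {ω | cornerFunctional ω n ∈ S} =
      S.card / Fintype.card (unitriangular K n) := by
  have e : {ω : ℕ × ℕ → K | cornerFunctional ω n ∈ S} =
      ⋃ m ∈ S, {ω | cornerFunctional ω n = m} := by
    ext ω
    simp
  rw [e, measureReal_biUnion_finset]
  · simp only [arrayMeasure_cornerFunctional_eq]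
    simp [div_eq_mul_inv]
  · intro l _ m _ hlm
    rw [Function.onFun, Set.disjoint_left]
    rintro ω rfl h
    exact hlm h
  · intro m _
    have := measurable_comp_cornerFunctional (K := K) n fun l => (l = m)
    exact measurableSet_setOfPred.2 this

/-- The path in the Bratteli diagram given by the corners of an infinite array. -/
noncomputable def arrayPath {θ : AddChar K ℂ} (hθ : θ ≠ 1) (ω : ℕ × ℕ → K) : BratteliPath θ :=
  ⟨fun n => arcType (cornerFunctional ω n), fun n => by
    classical
    -- The next corner is itself an extension of the current one, so the extension count is
    -- positive.
    rw [edgeMultiplicity_ne_zero_iff hθ, ← card_extensions (mem_arcClass_iff.2 rfl)]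
    exact Finset.card_ne_zero_of_mem
      (Finset.mem_filter.2 ⟨mem_arcClass_iff.2 rfl, cornerFunctional_succ ω n⟩)⟩

lemma measurable_arrayPath {θ : AddChar K ℂ} (hθ : θ ≠ 1) : Measurable (arrayPath hθ) :=
  Measurable.subtype_mk (measurable_pi_lambda _ fun n => measurable_comp_cornerFunctional n arcType)

end RandomArray

/-! ### Existence and uniqueness of the path measure. -/

section PathMeasure

variable {K : Type*} [Field K] [Fintype K] {θ : AddChar K ℂ}

lemma measurable_val_apply (n : ℕ) : Measurable fun ω : BratteliPath θ => ω.val n :=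
  (measurable_pi_apply n).comp measurable_subtype_coe

lemma exists_isPathMeasure (hθ : θ ≠ 1) :
    ∃ P : Measure (BratteliPath θ), IsPathMeasure θ P ∧
      ∀ (n : ℕ) (π : SetPartition n),
        ((P.real {ω | ω.val n = π} : ℝ) : ℂ) = superPlancherel θ π := by
  let : MeasurableSpace K := ⊤
  have hΦ := measurable_arrayPath hθ
  refine ⟨(arrayMeasure K).map (arrayPath hθ), ⟨Measure.isProbabilityMeasure_map hΦ.aemeasurable,
    fun N γ => ?_⟩, fun n π => ?_⟩
  · rw [map_measureReal_apply hΦ, prod_transition hθ]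
    · have := arrayMeasure_cornerFunctional_mem (pathClass K γ N)
      simp only [cornerFunctional_mem_pathClass] at this
      simp only [arrayPath, Set.preimage_ofPred_eq, this]
      push_cast
      rfl
    · simp only [Set.ofPred_forall]
      exact MeasurableSet.iInter fun n => MeasurableSet.iInter fun _ =>
        measurable_val_apply n (measurableSet_singleton _)
  · have hm : MeasurableSet {ω : BratteliPath θ | ω.val n = π} :=
      measurable_val_apply n (measurableSet_singleton _)
    rw [map_measureReal_apply hΦ hm, superPlancherel_eq hθ]
    have := arrayMeasure_cornerFunctional_mem (arcClass K π)
    simp only [mem_arcClass_iff] at this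
    simp only [arrayPath, Set.preimage_ofPred_eq, this]
    push_cast
    rfl

/-- Initial segments take finitely many values, whose probabilities are prescribed; so all
finite-dimensional marginals agree on the full product, and the path space carries the induced
σ-algebra. -/
lemma IsPathMeasure.unique {P Q : Measure (BratteliPath θ)} (hP : IsPathMeasure θ P)
    (hQ : IsPathMeasure θ Q) : P = Q := by
  classical
  have := hP.1
  have := hQ.1
  have hmap : ∀ I : Finset ℕ, (P.map Subtype.val).map I.restrict =
      (Q.map Subtype.val).map I.restrict := by
    have key : ∀ N : ℕ, (P.map Subtype.val).map (Finset.range (N + 1)).restrict =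
        (Q.map Subtype.val).map (Finset.range (N + 1)).restrict := by
      intro N
      refine Measure.ext_of_singleton fun b => ?_
      -- `IsPathMeasure` expects an infinite sequence; beyond `N` it is filled with the arbitrary
      -- value `⊥`.
      have e : Subtype.val ⁻¹' ((Finset.range (N + 1)).restrict ⁻¹' {b}) =
          {ω : BratteliPath θ | ∀ n ≤ N, ω.val n =
            if h : n ∈ Finset.range (N + 1) then b ⟨n, h⟩ else ⊥} := by
        ext ω
        simp only [Set.mem_preimage, Set.mem_singleton_iff, Set.mem_ofPred_eq, funext_iff]
        constructor
        · intro h n hn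
          have hn' : n ∈ Finset.range (N + 1) := Finset.mem_range.2 (by omega)
          rw [dif_pos hn', ← h ⟨n, hn'⟩]
          rfl
        · rintro h ⟨n, hn⟩
          have := h n (by have := Finset.mem_range.1 hn; omega)
          rwa [dif_pos hn] at this
      have hm := Finset.measurable_restrict (X := SetPartition) (Finset.range (N + 1))
      rw [Measure.map_apply hm (measurableSet_singleton b),
        Measure.map_apply measurable_subtype_coe (hm (measurableSet_singleton b)),
        Measure.map_apply hm (measurableSet_singleton b),
        Measure.map_apply measurable_subtype_coe (hm (measurableSet_singleton b)), e,
        ← measureReal_eq_measureReal_iff]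
      exact_mod_cast (hP.2 N _).trans (hQ.2 N _).symm
    intro I
    obtain ⟨N, hN⟩ : ∃ N, I ⊆ Finset.range (N + 1) := by
      obtain ⟨N, hN⟩ := I.exists_nat_subset_range
      exact ⟨N, hN.trans (Finset.range_mono (Nat.le_succ N))⟩
    rw [← Finset.restrict₂_comp_restrict hN,
      ← Measure.map_map (Finset.measurable_restrict₂ hN) (Finset.measurable_restrict _),
      ← Measure.map_map (Finset.measurable_restrict₂ hN) (Finset.measurable_restrict _), key]
  have h : P.map Subtype.val = Q.map Subtype.val := by
    have := Measure.isProbabilityMeasure_map (μ := Q)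
      (measurable_subtype_coe (p := fun ω : ∀ n : ℕ, SetPartition n =>
        ∀ n, edgeMultiplicity θ (ω n) (ω (n + 1)) ≠ 0)).aemeasurable
    have : ∀ I : Finset ℕ, IsFiniteMeasure ((Q.map Subtype.val).map
      (I.restrict (π := SetPartition))) := fun I => inferInstance
    exact IsProjectiveLimit.unique (P := fun I => (Q.map Subtype.val).map I.restrict) hmap
      fun I => rfl
  ext s hs
  obtain ⟨t, ht, rfl⟩ := hs
  rw [← Measure.map_apply measurable_subtype_coe ht, h, Measure.map_apply measurable_subtype_coe ht]

end PathMeasure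

/-! ### Upper bound for the size of an arc class. -/

section OrbitBound

variable {K : Type*} [Field K] {n : ℕ}

lemma comp_twoSidedMul_congr {l : Module.Dual K (strictUpper K n)}
    {a a' b b' : unitriangular K n} (ha : l ∘ₗ twoSidedMul a 1 = l ∘ₗ twoSidedMul a' 1)
    (hb : l ∘ₗ twoSidedMul 1 b = l ∘ₗ twoSidedMul 1 b') :
    l ∘ₗ twoSidedMul a b = l ∘ₗ twoSidedMul a' b' := by
  calc l ∘ₗ twoSidedMul a b = (l ∘ₗ twoSidedMul a 1) ∘ₗ twoSidedMul 1 b := by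
        rw [LinearMap.comp_assoc, twoSidedMul_comp, mul_one, mul_one]
    _ = (l ∘ₗ twoSidedMul 1 b) ∘ₗ twoSidedMul a' 1 := by
        rw [ha, LinearMap.comp_assoc, LinearMap.comp_assoc, twoSidedMul_comp, twoSidedMul_comp]
        simp
    _ = l ∘ₗ twoSidedMul a' b' := by
        rw [hb, LinearMap.comp_assoc, twoSidedMul_comp]
        simp

lemma entry_add (l m : Module.Dual K (strictUpper K n)) (i j : Fin n) :
    entry (l + m) i j = entry l i j + entry m i j := rfl

lemma oneAdd_subOne (a : unitriangular K n) : oneAdd (subOne a) = a :=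
  subOne_bijective.1 (subOne_oneAdd _)

variable [Fintype K]

open scoped Classical in
/-- The orbit of a functional under the right action of `U_n(K)`. -/
noncomputable def rightOrbit (l : Module.Dual K (strictUpper K n)) :
    Finset (Module.Dual K (strictUpper K n)) :=
  Finset.univ.image fun b : unitriangular K n => l ∘ₗ twoSidedMul 1 b

lemma mem_rightOrbit {l m : Module.Dual K (strictUpper K n)} :
    m ∈ rightOrbit l ↔ ∃ b, l ∘ₗ twoSidedMul 1 b = m := by
  simp [rightOrbit]

open scoped Classical in
-- A pair `(m, d)` is encoded by a left translate and a right translate of `l`. As `d` is both the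
-- left translate by `C d` and the right translate by `D d`, inserting `(C d)⁻¹` and `D d` does not
-- change `m`; so the two translates determine `m`, and cancelling `B m` recovers `d`.
lemma card_twoSidedOrbit_mul_le (l : Module.Dual K (strictUpper K n)) :
    (twoSidedOrbit l).card * (leftOrbit l ∩ rightOrbit l).card ≤
      (leftOrbit l).card * (rightOrbit l).card := by
  have h1 : ∀ m, ∃ a b : unitriangular K n, m ∈ twoSidedOrbit l → l ∘ₗ twoSidedMul a b = m := by
    intro m
    by_cases h : m ∈ twoSidedOrbit l
    · obtain ⟨a, b, h'⟩ := mem_twoSidedOrbit.1 h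
      exact ⟨a, b, fun _ => h'⟩
    · exact ⟨1, 1, fun h' => absurd h' h⟩
  have h2 : ∀ m, ∃ a b : unitriangular K n, m ∈ leftOrbit l ∩ rightOrbit l →
      l ∘ₗ twoSidedMul a 1 = m ∧ l ∘ₗ twoSidedMul 1 b = m := by
    intro m
    by_cases h : m ∈ leftOrbit l ∩ rightOrbit l
    · obtain ⟨h, h'⟩ := Finset.mem_inter.1 h
      obtain ⟨a, ha⟩ := mem_leftOrbit.1 h
      obtain ⟨b, hb⟩ := mem_rightOrbit.1 h'
      exact ⟨a, b, fun _ => ⟨ha, hb⟩⟩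
    · exact ⟨1, 1, fun h' => absurd h' h⟩
  choose A B hAB using h1
  choose C D hCD using h2
  rw [← Finset.card_product, ← Finset.card_product]
  have key : ∀ m d, m ∈ twoSidedOrbit l → d ∈ leftOrbit l ∩ rightOrbit l →
      l ∘ₗ twoSidedMul ((C d)⁻¹ * A m) (B m * D d) = m := by
    intro m d hm hd
    have e : twoSidedMul ((C d)⁻¹ * A m) (B m * D d) =
        twoSidedMul 1 (D d) ∘ₗ twoSidedMul ((C d)⁻¹ * A m) (B m) := by
      rw [twoSidedMul_comp, one_mul]
    have e' : l ∘ₗ twoSidedMul 1 (D d) = l ∘ₗ twoSidedMul (C d) 1 :=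
      (hCD d hd).2.trans (hCD d hd).1.symm
    rw [e, ← LinearMap.comp_assoc, e', LinearMap.comp_assoc, twoSidedMul_comp, mul_one,
      mul_inv_cancel_left, hAB m hm]
  refine Finset.card_le_card_of_injOn (fun p => (l ∘ₗ twoSidedMul ((C p.2)⁻¹ * A p.1) 1,
    l ∘ₗ twoSidedMul 1 (B p.1 * D p.2))) ?_ ?_
  · intro p _
    exact Finset.mem_product.2 ⟨mem_leftOrbit.2 ⟨_, rfl⟩, mem_rightOrbit.2 ⟨_, rfl⟩⟩
  · rintro ⟨m, d⟩ hp ⟨m', d'⟩ hp' h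
    obtain ⟨hm, hd⟩ := Finset.mem_product.1 (Finset.mem_coe.1 hp)
    obtain ⟨hm', hd'⟩ := Finset.mem_product.1 (Finset.mem_coe.1 hp')
    obtain ⟨e1, e2⟩ := Prod.mk.inj h
    dsimp only at e1 e2 hm hd hm' hd'
    have e : m = m' := by
      rw [← key m d hm hd, ← key m' d' hm' hd']
      exact comp_twoSidedMul_congr e1 e2
    subst e
    have e3 : ∀ d, l ∘ₗ twoSidedMul 1 (B m * D d) =
        (l ∘ₗ twoSidedMul 1 (D d)) ∘ₗ twoSidedMul 1 (B m) := by
      intro d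
      rw [LinearMap.comp_assoc, twoSidedMul_comp, one_mul]
    rw [e3, e3, (hCD d hd).2, (hCD d' hd').2] at e2
    have e4 := congrArg (· ∘ₗ twoSidedMul (1 : unitriangular K n)⁻¹ (B m)⁻¹) e2
    simp only [comp_twoSidedMul_inv] at e4
    rw [e4]

/-- The positions `(k, j)` with `i < k < j` for some arc `(i, j)`. -/
noncomputable def colCells (π : SetPartition n) : Finset (Fin n × Fin n) :=
  open scoped Classical in
  Finset.univ.filter fun p => ∃ i, (i, p.2) ∈ π.arcs ∧ i < p.1 ∧ p.1 < p.2

/-- The positions `(i, k)` with `i < k < j` for some arc `(i, j)`. -/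
noncomputable def rowCells (π : SetPartition n) : Finset (Fin n × Fin n) :=
  open scoped Classical in
  Finset.univ.filter fun p => ∃ j, (p.1, j) ∈ π.arcs ∧ p.1 < p.2 ∧ p.2 < j

lemma mem_colCells {π : SetPartition n} {k j : Fin n} :
    (k, j) ∈ colCells π ↔ ∃ i, (i, j) ∈ π.arcs ∧ i < k ∧ k < j := by
  simp [colCells]

lemma mem_rowCells {π : SetPartition n} {i k : Fin n} :
    (i, k) ∈ rowCells π ↔ ∃ j, (i, j) ∈ π.arcs ∧ i < k ∧ k < j := by
  simp [rowCells]

lemma sum_card_Ioo (π : SetPartition n) :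
    ∑ a ∈ π.arcs, (Finset.Ioo a.1 a.2).card + π.arcs.card = π.dim := by
  rw [SetPartition.dim, Finset.card_eq_sum_ones, ← Finset.sum_add_distrib]
  refine Finset.sum_congr rfl fun a ha => ?_
  have h : (a.1 : ℕ) < a.2 := SetPartition.lt_of_mem_arcs ha
  rw [Fin.card_Ioo]
  omega

/-- An arc `(i, j)` contributes `j - i - 1` cells. The missing 1 per arc later pays for the choice
of colours. -/
lemma card_colCells_add_le (π : SetPartition n) : (colCells π).card + π.arcs.card ≤ π.dim := by
  classical
  rw [← sum_card_Ioo]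
  refine Nat.add_le_add_right ?_ _
  have h : colCells π ⊆ π.arcs.biUnion fun a => (Finset.Ioo a.1 a.2).image fun k => (k, a.2) := by
    rintro ⟨k, j⟩ h
    obtain ⟨i, hi, h1, h2⟩ := mem_colCells.1 h
    exact Finset.mem_biUnion.2 ⟨_, hi, Finset.mem_image.2 ⟨k, Finset.mem_Ioo.2 ⟨h1, h2⟩, rfl⟩⟩
  exact (Finset.card_le_card h).trans
    (Finset.card_biUnion_le.trans (Finset.sum_le_sum fun a _ => Finset.card_image_le))

lemma card_rowCells_add_le (π : SetPartition n) : (rowCells π).card + π.arcs.card ≤ π.dim := by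
  classical
  rw [← sum_card_Ioo]
  refine Nat.add_le_add_right ?_ _
  have h : rowCells π ⊆ π.arcs.biUnion fun a => (Finset.Ioo a.1 a.2).image fun k => (a.1, k) := by
    rintro ⟨i, k⟩ h
    obtain ⟨j, hj, h1, h2⟩ := mem_rowCells.1 h
    exact Finset.mem_biUnion.2 ⟨_, hj, Finset.mem_image.2 ⟨k, Finset.mem_Ioo.2 ⟨h1, h2⟩, rfl⟩⟩
  exact (Finset.card_le_card h).trans
    (Finset.card_biUnion_le.trans (Finset.sum_le_sum fun a _ => Finset.card_image_le))

open scoped Classical in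
-- A crossing of `(i, j)` with `(k, l)` is sent to the cell `(k, j)`, from which `i` and `l` are
-- recovered by uniqueness of arcs.
lemma crs_le_card (π : SetPartition n) : π.crs ≤ (colCells π ∩ rowCells π).card := by
  rw [SetPartition.crs]
  refine Finset.card_le_card_of_injOn (fun p => (p.2.1, p.1.2)) ?_ ?_
  · rintro ⟨⟨i, j⟩, ⟨k, l⟩⟩ hp
    obtain ⟨h, h1, h2, h3⟩ := Finset.mem_filter.1 (Finset.mem_coe.1 hp)
    obtain ⟨h4, h5⟩ := Finset.mem_product.1 h
    exact Finset.mem_inter.2 ⟨mem_colCells.2 ⟨i, h4, h1, h2⟩, mem_rowCells.2 ⟨l, h5, h2, h3⟩⟩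
  · rintro ⟨⟨i, j⟩, ⟨k, l⟩⟩ hp ⟨⟨i', j'⟩, ⟨k', l'⟩⟩ hp' e
    obtain ⟨h4, h5⟩ := Finset.mem_product.1 (Finset.mem_filter.1 (Finset.mem_coe.1 hp)).1
    obtain ⟨h4', h5'⟩ := Finset.mem_product.1 (Finset.mem_filter.1 (Finset.mem_coe.1 hp')).1
    obtain ⟨e1, e2⟩ := Prod.mk.inj e
    dsimp only at e1 e2 h4 h5 h4' h5'
    subst e1 e2
    rw [SetPartition.arcs_left_unique h4 h4', SetPartition.arcs_right_unique h5 h5']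

lemma card_le_of_entry_eq {S : Finset (Module.Dual K (strictUpper K n))}
    {T : Finset (Fin n × Fin n)} (l : Module.Dual K (strictUpper K n))
    (h : ∀ m ∈ S, ∀ i j, (i, j) ∉ T → entry m i j = entry l i j) :
    S.card ≤ Fintype.card K ^ T.card := by
  classical
  have e : Fintype.card K ^ T.card = (Finset.univ : Finset (T → K)).card := by simp
  rw [e]
  refine Finset.card_le_card_of_injOn (fun m (p : T) => entry m p.1.1 p.1.2)
    (fun _ _ => Finset.mem_coe.2 (Finset.mem_univ _)) fun m hm m' hm' hmm => ?_
  refine dual_ext fun i j _ => ?_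
  by_cases hij : (i, j) ∈ T
  · exact congrFun hmm ⟨(i, j), hij⟩
  · rw [h m hm i j hij, h m' hm' i j hij]

lemma le_card_of_add_ofEntries_mem {S : Finset (Module.Dual K (strictUpper K n))}
    {T : Finset (Fin n × Fin n)} (hT : ∀ i j, (i, j) ∈ T → i < j)
    (l : Module.Dual K (strictUpper K n))
    (h : ∀ C : Fin n → Fin n → K, (∀ i j, (i, j) ∉ T → C i j = 0) → l + ofEntries C ∈ S) :
    Fintype.card K ^ T.card ≤ S.card := by
  classical
  have e : Fintype.card K ^ T.card = (Finset.univ : Finset (T → K)).card := by simp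
  rw [e]
  refine Finset.card_le_card_of_injOn (fun C => l + ofEntries fun i j =>
    if h : (i, j) ∈ T then C ⟨(i, j), h⟩ else 0) (fun C _ => Finset.mem_coe.2 (h _ ?_)) ?_
  · intro i j hij
    rw [dif_neg hij]
  · intro C _ C' _ hC
    have hC := add_left_cancel hC
    funext ⟨⟨i, j⟩, hij⟩
    have := congrArg (fun m => entry m i j) hC
    simpa [entry_ofEntries _ (hT i j hij), hij] using this

variable (π : SetPartition n) (φ : π.arcs → Kˣ)

lemma card_leftOrbit_le :
    (leftOrbit (arcFunctional π φ)).card ≤ Fintype.card K ^ (colCells π).card := by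
  refine card_le_of_entry_eq (arcFunctional π φ) fun m hm k j hkj => ?_
  obtain ⟨a, rfl⟩ := mem_leftOrbit.1 hm
  rw [← oneAdd_subOne a]
  rcases lt_or_ge k j with h | h
  · rw [entry_comp_left _ _ h, Finset.sum_eq_zero, add_zero]
    intro i _
    by_cases hij : (i, j) ∈ π.arcs
    · rw [(subOne a).2 i k, zero_mul]
      by_contra hki
      exact hkj (mem_colCells.2 ⟨i, hij, not_le.1 hki, h⟩)
    · rw [entry_arcFunctional_of_notMem φ hij, mul_zero]
  · rw [entry_of_le _ h, entry_of_le _ h]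

lemma card_rightOrbit_le :
    (rightOrbit (arcFunctional π φ)).card ≤ Fintype.card K ^ (rowCells π).card := by
  refine card_le_of_entry_eq (arcFunctional π φ) fun m hm i k hik => ?_
  obtain ⟨b, rfl⟩ := mem_rightOrbit.1 hm
  rw [← oneAdd_subOne b]
  rcases lt_or_ge i k with h | h
  · rw [entry_comp_right _ _ h, Finset.sum_eq_zero, add_zero]
    intro j _
    by_cases hij : (i, j) ∈ π.arcs
    · rw [(subOne b).2 k j, mul_zero]
      by_contra hki
      exact hik (mem_rowCells.2 ⟨j, hij, h, not_le.1 hki⟩)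
    · rw [entry_arcFunctional_of_notMem φ hij, zero_mul]
  · rw [entry_of_le _ h, entry_of_le _ h]

lemma add_ofEntries_mem_leftOrbit {C : Fin n → Fin n → K}
    (hC : ∀ k j, (k, j) ∉ colCells π → C k j = 0) :
    arcFunctional π φ + ofEntries C ∈ leftOrbit (arcFunctional π φ) := by
  classical
  -- The equation to solve is `X i k * φ (i, j) = C k j` for each arc `(i, j)`. The sum over `j` has
  -- at most one nonzero term, since `0⁻¹ = 0` and row `i` has at most one arc.
  let X : strictUpper K n := ⟨Matrix.of fun i k => if i < k then
    ∑ j, C k j * (entry (arcFunctional π φ) i j)⁻¹ else 0, fun i k h => by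
      rw [Matrix.of_apply, if_neg (not_lt.2 h)]⟩
  refine mem_leftOrbit.2 ⟨oneAdd X, dual_ext fun k j hkj => ?_⟩
  rw [entry_comp_left _ _ hkj, entry_add, entry_ofEntries _ hkj]
  congr 1
  by_cases h : ∃ i, (i, j) ∈ π.arcs
  · obtain ⟨i, hi⟩ := h
    rw [Finset.sum_eq_single i]
    · change (if i < k then _ else 0) * _ = _
      split_ifs with hik
      · rw [Finset.sum_eq_single j]
        · exact inv_mul_cancel_right₀ ((entry_arcFunctional_ne_zero φ).2 hi) _
        · intro j' _ hj'
          rw [entry_arcFunctional_of_notMem, inv_zero, mul_zero]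
          exact fun h' => hj' (SetPartition.arcs_right_unique h' hi)
        · simp
      · rw [hC k j, zero_mul]
        intro h'
        obtain ⟨i', hi', hik', -⟩ := mem_colCells.1 h'
        exact hik (SetPartition.arcs_left_unique hi' hi ▸ hik')
    · intro i' _ hi'
      rw [entry_arcFunctional_of_notMem, mul_zero]
      exact fun h' => hi' (SetPartition.arcs_left_unique h' hi)
    · simp
  · rw [hC k j, Finset.sum_eq_zero]
    · intro i _
      rw [entry_arcFunctional_of_notMem _ fun h' => h ⟨i, h'⟩, mul_zero]
    · intro h'
      obtain ⟨i, hi, -⟩ := mem_colCells.1 h'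
      exact h ⟨i, hi⟩

lemma add_ofEntries_mem_rightOrbit {C : Fin n → Fin n → K}
    (hC : ∀ i k, (i, k) ∉ rowCells π → C i k = 0) :
    arcFunctional π φ + ofEntries C ∈ rightOrbit (arcFunctional π φ) := by
  classical
  let X : strictUpper K n := ⟨Matrix.of fun k j => if k < j then
    ∑ i, C i k * (entry (arcFunctional π φ) i j)⁻¹ else 0, fun i k h => by
      rw [Matrix.of_apply, if_neg (not_lt.2 h)]⟩
  refine mem_rightOrbit.2 ⟨oneAdd X, dual_ext fun i k hik => ?_⟩
  rw [entry_comp_right _ _ hik, entry_add, entry_ofEntries _ hik]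
  congr 1
  by_cases h : ∃ j, (i, j) ∈ π.arcs
  · obtain ⟨j, hj⟩ := h
    rw [Finset.sum_eq_single j]
    · change _ * (if k < j then _ else 0) = _
      split_ifs with hkj
      · rw [Finset.sum_eq_single i]
        · rw [mul_comm]
          exact inv_mul_cancel_right₀ ((entry_arcFunctional_ne_zero φ).2 hj) _
        · intro i' _ hi'
          rw [entry_arcFunctional_of_notMem, inv_zero, mul_zero]
          exact fun h' => hi' (SetPartition.arcs_left_unique h' hj)
        · simp
      · rw [hC i k, mul_zero]
        intro h'
        obtain ⟨j', hj', -, hkj'⟩ := mem_rowCells.1 h'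
        exact hkj (SetPartition.arcs_right_unique hj' hj ▸ hkj')
    · intro j' _ hj'
      rw [entry_arcFunctional_of_notMem, zero_mul]
      exact fun h' => hj' (SetPartition.arcs_right_unique h' hj)
    · simp
  · rw [hC i k, Finset.sum_eq_zero]
    · intro j _
      rw [entry_arcFunctional_of_notMem _ fun h' => h ⟨j, h'⟩, zero_mul]
    · intro h'
      obtain ⟨j, hj, -⟩ := mem_rowCells.1 h'
      exact h ⟨j, hj⟩

open scoped Classical in
-- Entries at the cells in `colCells π ∩ rowCells π` can be altered freely by either one-sided
-- action.
lemma pow_crs_le :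
    Fintype.card K ^ π.crs ≤
      (leftOrbit (arcFunctional π φ) ∩ rightOrbit (arcFunctional π φ)).card := by
  refine (Nat.pow_le_pow_right Fintype.card_pos (crs_le_card π)).trans
    (le_card_of_add_ofEntries_mem (fun i j h => ?_) (arcFunctional π φ) fun C hC => ?_)
  · obtain ⟨-, -, -, h⟩ := mem_colCells.1 (Finset.mem_inter.1 h).1
    exact h
  · exact Finset.mem_inter.2 ⟨add_ofEntries_mem_leftOrbit π φ fun k j h =>
      hC k j fun h' => h (Finset.mem_inter.1 h').1, add_ofEntries_mem_rightOrbit π φ fun k j h =>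
      hC k j fun h' => h (Finset.mem_inter.1 h').2⟩

lemma card_twoSidedOrbit_mul_pow_crs_le :
    (twoSidedOrbit (arcFunctional π φ)).card * Fintype.card K ^ π.crs ≤
      Fintype.card K ^ ((colCells π).card + (rowCells π).card) := by
  classical
  rw [pow_add]
  exact (Nat.mul_le_mul_left _ (pow_crs_le π φ)).trans ((card_twoSidedOrbit_mul_le _).trans
    (Nat.mul_le_mul (card_leftOrbit_le π φ) (card_rightOrbit_le π φ)))

lemma card_arcClass_mul_pow_crs_le :
    (arcClass K π).card * Fintype.card K ^ π.crs ≤ Fintype.card K ^ (2 * π.dim) := by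
  classical
  have hK : 0 < Fintype.card K := Fintype.card_pos
  have h1 : (arcClass K π).card ≤
      ∑ φ : π.arcs → Kˣ, (twoSidedOrbit (arcFunctional π φ)).card := by
    convert Finset.card_biUnion_le (s := (Finset.univ : Finset (π.arcs → Kˣ)))
      (t := fun φ => twoSidedOrbit (arcFunctional π φ))
    ext m
    simp [mem_arcClass]
  have h2 : Fintype.card (π.arcs → Kˣ) ≤ Fintype.card K ^ π.arcs.card := by
    rw [Fintype.card_fun, Fintype.card_coe]
    exact Nat.pow_le_pow_left (Fintype.card_le_of_injective _ Units.val_injective) _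
  calc (arcClass K π).card * Fintype.card K ^ π.crs
      ≤ ∑ φ : π.arcs → Kˣ, (twoSidedOrbit (arcFunctional π φ)).card * Fintype.card K ^ π.crs := by
        rw [← Finset.sum_mul]
        exact Nat.mul_le_mul_right _ h1
    _ ≤ ∑ _φ : π.arcs → Kˣ, Fintype.card K ^ ((colCells π).card + (rowCells π).card) :=
        Finset.sum_le_sum fun φ _ => card_twoSidedOrbit_mul_pow_crs_le π φ
    _ = Fintype.card (π.arcs → Kˣ) * Fintype.card K ^ ((colCells π).card + (rowCells π).card) := by
        rw [Finset.sum_const, Finset.card_univ, smul_eq_mul]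
    _ ≤ Fintype.card K ^ π.arcs.card * Fintype.card K ^ ((colCells π).card + (rowCells π).card) :=
        Nat.mul_le_mul_right _ h2
    _ ≤ Fintype.card K ^ (2 * π.dim) := by
        rw [← pow_add]
        refine Nat.pow_le_pow_right hK ?_
        have := card_colCells_add_le π
        have := card_rowCells_add_le π
        omega

end OrbitBound

/-! ### Deterministic bounds, Borel–Cantelli and the limits. -/

section Asymptotics

/-- A set partition is determined by its successor map on `Fin n`, where the last element of each
block is fixed. -/
lemma SetPartition.card_le (n : ℕ) : Fintype.card (SetPartition n) ≤ n ^ n := by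
  classical
  have e : n ^ n = Fintype.card (Fin n → Fin n) := by simp
  rw [e]
  let next : SetPartition n → Fin n → Fin n := fun π i =>
    if h : ∃ j, (i, j) ∈ π.arcs then h.choose else i
  have key : ∀ (π : SetPartition n) i j, (i, j) ∈ π.arcs ↔ i ≠ j ∧ next π i = j := by
    intro π i j
    by_cases h : ∃ j, (i, j) ∈ π.arcs
    · simp only [next, dif_pos h]
      constructor
      · exact fun h' => ⟨(lt_of_mem_arcs h').ne, arcs_right_unique h.choose_spec h'⟩
      · rintro ⟨-, h'⟩
        exact h' ▸ h.choose_spec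
    · simp only [next, dif_neg h]
      exact ⟨fun h' => absurd ⟨j, h'⟩ h, fun h' => absurd h'.2 h'.1⟩
  refine Fintype.card_le_of_injective next fun π σ h => arcs_injective ?_
  ext ⟨i, j⟩
  rw [key, key, h]

/-- Passing from `n` to `n + 2` adds two end terms `n + 1` and recentres the others. -/
lemma two_mul_sum_range_abs_le (n : ℕ) :
    2 * ∑ k ∈ Finset.range n, |2 * (k : ℤ) - (n - 1)| ≤ (n : ℤ) ^ 2 := by
  induction n using Nat.twoStepInduction with
  | zero => simp
  | one => simp
  | more n ih _ =>
    have e : ∀ k ∈ Finset.range n,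
        |2 * ((k + 1 : ℕ) : ℤ) - ((n + 1 + 1 : ℕ) - 1)| = |2 * (k : ℤ) - (n - 1)| := by
      intro k _
      congr 1
      push_cast
      ring
    rw [show n + 2 = n + 1 + 1 from rfl, Finset.sum_range_succ, Finset.sum_range_succ',
      Finset.sum_congr rfl e]
    have h1 : |2 * ((0 : ℕ) : ℤ) - ((n + 1 + 1 : ℕ) - 1)| = n + 1 := by
      push_cast
      rw [abs_of_nonpos] <;> linarith [Int.natCast_nonneg n]
    have h2 : |2 * ((n + 1 : ℕ) : ℤ) - ((n + 1 + 1 : ℕ) - 1)| = n + 1 := by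
      push_cast
      rw [abs_of_nonneg] <;> linarith [Int.natCast_nonneg n]
    rw [h1, h2]
    push_cast
    nlinarith

/-- With the centred coordinate `f`, `2 dim` is the sum of `f j - f i` over arcs. Right endpoints
are distinct, as are left endpoints, so the sum is at most that of the positive parts plus that of
the negative parts of `f`, the sum of `|f|`. -/
lemma SetPartition.four_mul_dim_le {n : ℕ} (π : SetPartition n) : 4 * π.dim ≤ n ^ 2 := by
  classical
  let f : Fin n → ℤ := fun k => 2 * ((k : ℕ) : ℤ) - (n - 1)
  have hR : ∑ a ∈ π.arcs, f a.2 ≤ ∑ k, max (f k) 0 := by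
    rw [← Finset.sum_image (f := f) (g := fun a : Fin n × Fin n => a.2)]
    · exact (Finset.sum_le_sum fun k _ => le_max_left (f k) 0).trans
        (Finset.sum_le_sum_of_subset_of_nonneg (Finset.subset_univ _) fun k _ _ => le_max_right _ _)
    · rintro ⟨i, j⟩ h ⟨i', j'⟩ h' e
      dsimp only at e
      subst e
      rw [arcs_left_unique h h']
  have hL : ∑ a ∈ π.arcs, -f a.1 ≤ ∑ k, max (-f k) 0 := by
    rw [← Finset.sum_image (f := fun k => -f k) (g := fun a : Fin n × Fin n => a.1)]
    · exact (Finset.sum_le_sum fun k _ => le_max_left (-f k) 0).trans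
        (Finset.sum_le_sum_of_subset_of_nonneg (Finset.subset_univ _) fun k _ _ => le_max_right _ _)
    · rintro ⟨i, j⟩ h ⟨i', j'⟩ h' e
      dsimp only at e
      subst e
      rw [arcs_right_unique h h']
  have hsum : ∑ k, max (f k) 0 + ∑ k, max (-f k) 0 = ∑ k, |f k| := by
    rw [← Finset.sum_add_distrib]
    refine Finset.sum_congr rfl fun k _ => ?_
    rcases le_total (f k) 0 with h | h
    · rw [max_eq_right h, max_eq_left (neg_nonneg.2 h), abs_of_nonpos h, zero_add]
    · rw [max_eq_left h, max_eq_right (neg_nonpos.2 h), abs_of_nonneg h, add_zero]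
  have hdim : 2 * (π.dim : ℤ) = ∑ a ∈ π.arcs, f a.2 + ∑ a ∈ π.arcs, -f a.1 := by
    rw [← Finset.sum_add_distrib, dim, Nat.cast_sum, Finset.mul_sum]
    refine Finset.sum_congr rfl fun a ha => ?_
    have h : (a.1 : ℕ) < a.2 := lt_of_mem_arcs ha
    rw [Nat.cast_sub h.le]
    simp only [f]
    ring
  have h := two_mul_sum_range_abs_le n
  rw [Finset.sum_range fun k : ℕ => |2 * (k : ℤ) - (n - 1)|] at h
  change 2 * ∑ k, |f k| ≤ _ at h
  zify
  linarith

variable {K : Type*} [Field K] [Fintype K] {θ : AddChar K ℂ}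

lemma card_arcClass_div_le {n : ℕ} (π : SetPartition n) {ε : ℝ}
    (h : 2 * (π.dim : ℝ) - π.crs < n ^ 2 / 2 - ε * n ^ 2) :
    ((arcClass K π).card : ℝ) / Fintype.card (unitriangular K n) ≤
      (Fintype.card K : ℝ) ^ ((n : ℝ) / 2 - ε * n ^ 2) := by
  have hq : (1 : ℝ) < Fintype.card K := by exact_mod_cast Fintype.one_lt_card
  have hq0 : (0 : ℝ) < Fintype.card K := by linarith
  have h1 : ((arcClass K π).card : ℝ) * (Fintype.card K : ℝ) ^ π.crs ≤
      (Fintype.card K : ℝ) ^ (2 * π.dim) := by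
    exact_mod_cast card_arcClass_mul_pow_crs_le (K := K) π
  have h2 : 2 * ((upperPairs n).card : ℝ) + n = n ^ 2 := by
    exact_mod_cast two_mul_card_upperPairs n
  rw [card_unitriangular]
  push_cast
  rw [div_le_iff₀ (by positivity)]
  refine le_of_mul_le_mul_right (h1.trans ?_) (pow_pos hq0 π.crs)
  simp only [← Real.rpow_natCast (Fintype.card K : ℝ)]
  rw [← Real.rpow_add hq0, ← Real.rpow_add hq0]
  refine Real.rpow_le_rpow_of_exponent_le hq.le ?_
  push_cast
  linarith

lemma measureReal_dim_crs_le {P : Measure (BratteliPath θ)} [IsFiniteMeasure P]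
    (hP : ∀ (n : ℕ) (π : SetPartition n), P.real {ω | ω.val n = π} =
      (arcClass K π).card / Fintype.card (unitriangular K n)) (ε : ℝ) (n : ℕ) :
    P.real {ω | 2 * ((ω.val n).dim : ℝ) - (ω.val n).crs < n ^ 2 / 2 - ε * n ^ 2} ≤
      (n * (Fintype.card K : ℝ) ^ ((1 : ℝ) / 2 - ε * n)) ^ n := by
  classical
  have hq0 : (0 : ℝ) ≤ Fintype.card K := Nat.cast_nonneg _
  let S : Finset (SetPartition n) := Finset.univ.filter fun π =>
    2 * (π.dim : ℝ) - π.crs < n ^ 2 / 2 - ε * n ^ 2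
  have e : {ω : BratteliPath θ | 2 * ((ω.val n).dim : ℝ) - (ω.val n).crs <
      n ^ 2 / 2 - ε * n ^ 2} = ⋃ π ∈ S, {ω | ω.val n = π} := by
    ext ω
    simp [S]
  have hS : (S.card : ℝ) ≤ n ^ n := by
    exact_mod_cast (Finset.card_le_univ S).trans (SetPartition.card_le n)
  calc _ ≤ ∑ π ∈ S, P.real {ω : BratteliPath θ | ω.val n = π} := by
        rw [e]
        exact measureReal_biUnion_finset_le _ _
    _ ≤ ∑ π ∈ S, (Fintype.card K : ℝ) ^ ((n : ℝ) / 2 - ε * n ^ 2) := by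
        refine Finset.sum_le_sum fun π hπ => ?_
        rw [hP]
        exact card_arcClass_div_le π (Finset.mem_filter.1 hπ).2
    _ = S.card * (Fintype.card K : ℝ) ^ ((n : ℝ) / 2 - ε * n ^ 2) := by
        rw [Finset.sum_const, nsmul_eq_mul]
    _ ≤ n ^ n * (Fintype.card K : ℝ) ^ ((n : ℝ) / 2 - ε * n ^ 2) :=
        mul_le_mul_of_nonneg_right hS (Real.rpow_nonneg hq0 _)
    _ = _ := by
        rw [mul_pow, ← Real.rpow_mul_natCast hq0]
        congr 2
        ring

/-- The base of the `n`-th power tends to 0, so it is eventually below `1 / 2`. -/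
lemma summable_pow_self_bound {q ε : ℝ} (hq : 1 < q) (hε : 0 < ε) :
    Summable fun n : ℕ => (n * q ^ ((1 : ℝ) / 2 - ε * n)) ^ n := by
  have hq0 : 0 < q := by linarith
  have hr : q ^ (-ε) < 1 := Real.rpow_lt_one_of_one_lt_of_neg hq (by linarith)
  have e : ∀ n : ℕ, (n : ℝ) * q ^ ((1 : ℝ) / 2 - ε * n) =
      q ^ ((1 : ℝ) / 2) * (n * (q ^ (-ε)) ^ n) := by
    intro n
    rw [← Real.rpow_mul_natCast hq0.le, mul_left_comm, ← Real.rpow_add hq0]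
    congr 2
    ring
  have ht := (tendsto_self_mul_const_pow_of_lt_one (Real.rpow_nonneg hq0.le _) hr).const_mul
    (q ^ ((1 : ℝ) / 2))
  rw [mul_zero] at ht
  have hev := ht.eventually_lt_const (show (0 : ℝ) < 1 / 2 by norm_num)
  refine Summable.of_norm_bounded_eventually_nat (g := fun n => (1 / 2 : ℝ) ^ n)
    summable_geometric_two ?_
  filter_upwards [hev] with n hn
  rw [e, Real.norm_of_nonneg (by positivity)]
  exact pow_le_pow_left₀ (by positivity) hn.le n

lemma ae_eventually_dim_crs {P : Measure (BratteliPath θ)} [IsFiniteMeasure P]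
    (hP : ∀ (n : ℕ) (π : SetPartition n), P.real {ω | ω.val n = π} =
      (arcClass K π).card / Fintype.card (unitriangular K n)) {ε : ℝ} (hε : 0 < ε) :
    ∀ᵐ ω ∂P, ∀ᶠ n : ℕ in atTop,
      (n : ℝ) ^ 2 / 2 - ε * n ^ 2 ≤ 2 * ((ω.val n).dim : ℝ) - (ω.val n).crs := by
  have hq : (1 : ℝ) < Fintype.card K := by exact_mod_cast Fintype.one_lt_card
  have hs := summable_pow_self_bound hq hε
  have hsum : ∑' n : ℕ, P {ω | 2 * ((ω.val n).dim : ℝ) - (ω.val n).crs <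
      (n : ℝ) ^ 2 / 2 - ε * n ^ 2} ≠ ⊤ := by
    refine ne_top_of_le_ne_top hs.tsum_ofReal_ne_top (ENNReal.tsum_le_tsum fun n => ?_)
    rw [← ofReal_measureReal]
    exact ENNReal.ofReal_le_ofReal (measureReal_dim_crs_le hP ε n)
  filter_upwards [ae_eventually_notMem hsum] with ω hω
  filter_upwards [hω] with n hn
  simpa using hn

/-- As `2 d ≤ n² / 2` and `c ≥ 0`, a lower bound on `2 d - c` close to `n² / 2` leaves no room for
`c` or for a deficit in `d`. -/
lemma tendsto_dim_crs {d c : ℕ → ℝ} (hd : ∀ n, 4 * d n ≤ n ^ 2) (hc : ∀ n, 0 ≤ c n)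
    (h : ∀ m : ℕ, ∀ᶠ n : ℕ in atTop,
      (n : ℝ) ^ 2 / 2 - 1 / (m + 1 : ℝ) * n ^ 2 ≤ 2 * d n - c n) :
    Tendsto (fun n : ℕ => d n / (n : ℝ) ^ 2) atTop (𝓝 (1 / 4)) ∧
      Tendsto (fun n : ℕ => c n / (n : ℝ) ^ 2) atTop (𝓝 0) := by
  constructor <;> refine Metric.tendsto_nhds.2 fun ε hε => ?_ <;>
    obtain ⟨m, hm⟩ := exists_nat_one_div_lt hε <;>
    filter_upwards [h m, eventually_gt_atTop 0] with n hn hn0 <;>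
    have hn2 : (0 : ℝ) < (n : ℝ) ^ 2 := by positivity
  · have hm2 := mul_lt_mul_of_pos_right hm hn2
    have e : d n / (n : ℝ) ^ 2 - 1 / 4 = (4 * d n - n ^ 2) / (4 * n ^ 2) := by
      field_simp
    rw [Real.dist_eq, e, abs_div, abs_of_nonpos (by linarith [hd n]), abs_of_pos (by positivity),
      div_lt_iff₀ (by positivity)]
    linarith [hc n, mul_pos hε hn2]
  · have hm2 := mul_lt_mul_of_pos_right hm hn2
    rw [Real.dist_eq, sub_zero, abs_of_nonneg (div_nonneg (hc n) hn2.le), div_lt_iff₀ hn2]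
    linarith [hd n]

end Asymptotics

theorem mainTheorem10 {K : Type*} [Field K] [Fintype K] (θ : AddChar K ℂ) (hθ : θ ≠ 1) :
    (∃! P : Measure (BratteliPath θ), IsPathMeasure θ P) ∧
    ∀ P : Measure (BratteliPath θ), IsPathMeasure θ P →
      (∀ (n : ℕ) (π : SetPartition n),
        ((P.real {ω | ω.val n = π} : ℝ) : ℂ) = superPlancherel θ π) ∧
      (∀ᵐ ω ∂P, Tendsto (fun n : ℕ => ((ω.val n).dim : ℝ) / (n : ℝ) ^ 2) atTop (𝓝 (1 / 4))) ∧
      TendstoInMeasure P (fun (n : ℕ) ω => ((ω.val n).crs : ℝ) / (n : ℝ) ^ 2) atTop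
        (fun _ => 0) := by
  obtain ⟨P₀, h₀, hlaw⟩ := exists_isPathMeasure hθ
  refine ⟨⟨P₀, h₀, fun P hP => hP.unique h₀⟩, fun P hP => ?_⟩
  obtain rfl := hP.unique h₀
  have := hP.1
  refine ⟨hlaw, ?_⟩
  have hreal : ∀ (n : ℕ) (π : SetPartition n), P.real {ω | ω.val n = π} =
      (arcClass K π).card / Fintype.card (unitriangular K n) := by
    intro n π
    refine Complex.ofReal_injective (((hlaw n π).trans (superPlancherel_eq hθ π)).trans ?_)
    push_cast
    rfl
  have hae : ∀ᵐ ω ∂P,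
      Tendsto (fun n : ℕ => ((ω.val n).dim : ℝ) / (n : ℝ) ^ 2) atTop (𝓝 (1 / 4)) ∧
      Tendsto (fun n : ℕ => ((ω.val n).crs : ℝ) / (n : ℝ) ^ 2) atTop (𝓝 0) := by
    -- Taking `ε = 1 / (m + 1)` leaves only countably many exceptional null sets.
    filter_upwards [ae_all_iff.2 fun m : ℕ =>
      ae_eventually_dim_crs hreal (Nat.one_div_pos_of_nat (α := ℝ) (n := m))] with ω hω
    exact tendsto_dim_crs (fun n => by exact_mod_cast (ω.val n).four_mul_dim_le)
      (fun n => Nat.cast_nonneg _) hω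
  refine ⟨hae.mono fun ω h => h.1, tendstoInMeasure_of_tendsto_ae (fun n => ?_)
    (hae.mono fun ω h => h.2)⟩
  have hm : Measurable fun π : SetPartition n => (π.crs : ℝ) / (n : ℝ) ^ 2 := fun _ _ => trivial
  exact (hm.comp (measurable_val_apply n)).aestronglyMeasurable
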